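/- Fix $m,n\in\mathbb{N}$, $\varepsilon>0$ and an integer $1\le s\le n$ such that $d=m/s$ is an integer. Let $A_s\in\{0,1\}^{m\times n}$ be a random matrix with independent columns, each having exactly $d$ ones, whose positions are drawn uniformly from $\{1,\dots,m\}$ without replacement; let $G\in\mathbb{R}^{m\times n}$ be a random matrix, independent of $A_s$, with i.i.d. standard Gaussian entries; let $\Phi_s=A_s\circ G$ be the entrywise product, and set $\Psi_s=\sqrt{\pi/2}\,\frac{s}{m}\,\Phi_s$ and $\beta_0=\sqrt{2/\pi}$. For $x\in\mathbb{R}^n$, order the indices by decreasing magnitude of the coordinates of $x$ (ties broken arbitrarily), let $S_1$ consist of the first $s$ indices, $S_2$ of the next $s$ indices, and so on up to $S_{\lceil n/s\rceil}$ (which may have fewer than $s$ elements), and put $$\|x\|_{1,2,s}=\Big(\sum_{\ell=1}^{\lceil n/s\rceil}\Big(\sum_{k\in S_\ell}|x_k|\Big)^2\Big)^{1/2}.$$ Then for every fixed $x\in\mathbb{R}^n$, with probability exceeding $$1-4n\exp\Big(-\frac{\varepsilon^2m}{8}\Big)-2\exp\Big(-\varepsilon^2\beta_0^2\,\frac{m}{8s}\Big(\frac{\|x\|_{1,2,s}}{\|x\|_2}\Big)^2\Big)$$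 we have $$(0.63-\varepsilon)\,\|x\|_{1,2,s}\le\|\Psi_sx\|_1\le(1.63+\varepsilon)\,\|x\|_{1,2,s}.$$ (For $x=0$ the quotient $\|x\|_{1,2,s}/\|x\|_2$ is read as $0$.) -/

import Mathlib

open MeasureTheory ProbabilityTheory
open scoped Matrix

noncomputable section

namespace BlockEmbedding

/-- A permutation of the indices listing the coordinates of `x` in order of decreasing magnitude:
`|x (σ 0)| ≥ |x (σ 1)| ≥ …` where `σ = decreasingOrder x`. -/
def decreasingOrder {n : ℕ} (x : Fin n → ℝ) : Equiv.Perm (Fin n) :=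
  Tuple.sort fun k => -|x k|

theorem decreasingOrder_antitone {n : ℕ} (x : Fin n → ℝ) :
    Antitone fun i => |x (decreasingOrder x i)| := by
  intro i j hij
  have h := Tuple.monotone_sort (fun k => -|x k|) hij
  simpa [decreasingOrder] using h

/-- The `ℓ`-th block (counted from `0`) of the `s`-block decreasing rearrangement of `x` along an
ordering `σ` of the indices: the indices whose position in the ordering lies in
`{ℓ s, …, ℓ s + s - 1}`. -/
def block {n : ℕ} (σ : Equiv.Perm (Fin n)) (s ℓ : ℕ) : Finset (Fin n) :=
  {k | ((σ.symm k : Fin n) : ℕ) / s = ℓ}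

/-- The norm `‖x‖_{1,2,s}`: the `ℓ₂` norm of the `ℓ₁` norms of the `⌈n/s⌉` blocks of the `s`-block
decreasing rearrangement of `x`. -/
def blockNorm {n : ℕ} (s : ℕ) (x : Fin n → ℝ) : ℝ :=
  √(∑ ℓ ∈ Finset.range (n ⌈/⌉ s), (∑ k ∈ block (decreasingOrder x) s ℓ, |x k|) ^ 2)

/-- The block norm does not depend on the way in which ties are broken. -/
theorem blockNorm_eq_of_antitone {n : ℕ} (s : ℕ) (x : Fin n → ℝ) (σ : Equiv.Perm (Fin n))
    (hσ : Antitone fun i => |x (σ i)|) :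
    blockNorm s x =
      √(∑ ℓ ∈ Finset.range (n ⌈/⌉ s), (∑ k ∈ block σ s ℓ, |x k|) ^ 2) := by
  have key : ∀ τ : Equiv.Perm (Fin n), ∀ ℓ,
      ∑ k ∈ block τ s ℓ, |x k| = ∑ i : Fin n, if (i : ℕ) / s = ℓ then |x (τ i)| else 0 := by
    intro τ ℓ
    rw [block, Finset.sum_filter, ← Equiv.sum_comp τ]
    simp
  have h : (fun k => |x k|) ∘ σ = (fun k => |x k|) ∘ decreasingOrder x :=
    Tuple.unique_antitone hσ (decreasingOrder_antitone x)
  have h' : ∀ i, |x (σ i)| = |x (decreasingOrder x i)| := fun i => congrFun h i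
  simp only [blockNorm, key, h']

/-- The vectors in `{0,1}^m` with exactly `d` ones. -/
def binaryColumns (m d : ℕ) : Set (Fin m → ℝ) :=
  {v | (∀ j, v j = 0 ∨ v j = 1) ∧ {j | v j = 1}.ncard = d}

variable {Ω : Type*} [MeasurableSpace Ω]

/-- `A` is a random `m × n` matrix of zeros and ones with exactly `d` ones in each column: the
columns are independent, and the positions of the `d` ones of a column are drawn uniformly from
the `m` rows without replacement, that is, each column is uniformly distributed on the binary
vectors with exactly `d` ones. -/
structure IsRandomBinaryMatrix {m n : ℕ} (d : ℕ) (A : Ω → Matrix (Fin m) (Fin n) ℝ)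
    (P : Measure Ω) : Prop where
  hasLaw_col : ∀ k, HasLaw (fun ω j => A ω j k) (uniformOn (binaryColumns m d)) P
  indep_cols : iIndepFun (fun (k : Fin n) ω j => A ω j k) P

/-- `G` is a random `m × n` matrix with i.i.d. standard Gaussian entries. -/
structure IsGaussianMatrix {m n : ℕ} (G : Ω → Matrix (Fin m) (Fin n) ℝ)
    (P : Measure Ω) : Prop where
  hasLaw_entry : ∀ j k, HasLaw (fun ω => G ω j k) (gaussianReal 0 1) P
  indep_entries : iIndepFun (fun (p : Fin m × Fin n) ω => G ω p.1 p.2) P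

/-- The random matrices `A` and `G` are independent. -/
def IndepMatrices {m n : ℕ} (A G : Ω → Matrix (Fin m) (Fin n) ℝ) (P : Measure Ω) : Prop :=
  IndepFun (fun ω (p : Fin m × Fin n) => A ω p.1 p.2) (fun ω (p : Fin m × Fin n) => G ω p.1 p.2) P

/-- `β₀ = √(2/π)`, the mean of the absolute value of a standard Gaussian variable. -/
def β₀ : ℝ := √(2 / Real.pi)

/-- The normalized matrix `Ψ = √(π/2) (s/m) (A ∘ G)`, with `∘` the entrywise product. -/
def Psi {m n : ℕ} (s : ℕ) (A G : Matrix (Fin m) (Fin n) ℝ) : Matrix (Fin m) (Fin n) ℝ :=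
  (√(Real.pi / 2) * ((s : ℝ) / (m : ℝ))) • (A ⊙ G)

end BlockEmbedding

end

namespace BlockEmbedding

/-! ### Moment generating function of the absolute value of a Gaussian. -/

section

open Real Filter Topology

/-! Write Y for the ℓ₁ norm of (A ∘ G)x. The proof bounds the moment generating function of Y about
its mean, then compares that mean with the block norm.

Given A, the rows of (A ∘ G)x are independent centred Gaussians with standard deviations R_j = √(∑
A_jk x_k²). The bound E exp(t|g|) ≤ exp(tβ₀ + t²/2) (`mgf_abs_gaussian_le`) leaves exp(tβ₀ ∑ R_j)
times a factor that does not depend on A: each column has exactly d ones, so ∑ R_j² = d‖x‖². Next, ∑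
R_j is subgaussian about its mean with variance proxy d‖x‖² (`lintegral_exp_sum_sqrt_le`). The
columns are revealed one at a time; each changes the conditional mean by a sum over d rows drawn
without replacement, which Maclaurin's inequality compares with draws with replacement, where
Hoeffding's lemma applies. Chernoff's bound then gives the tail.

Within one row the entries of A are independent Bernoulli variables with p = 1/s, so the mean is β₀
m E R for a single row norm R (`sqrtMean`). For the lower bound, R is tested by Cauchy–Schwarz
against the block sums, keeping only the first selected entry of each block; this costs 1 - (1 -
1/s)^s ≥ 1 - 1/e (`sqrtMean_ge`). For the upper bound, the first block is measured in ℓ₁ and the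
rest in ℓ₂, where each block is controlled by its predecessor (`sqrtMean_le`). -/

theorem integrable_exp_mul_abs_gaussian (t : ℝ) :
    Integrable (fun x : ℝ => exp (t * |x|)) (gaussianReal 0 1) :=
  integrable_exp_mul_abs (integrable_exp_mul_gaussianReal t) (integrable_exp_mul_gaussianReal (-t))

theorem integrableExpSet_abs_gaussian :
    integrableExpSet (fun x : ℝ => |x|) (gaussianReal 0 1) = Set.univ := by
  ext t
  simpa [integrableExpSet] using integrable_exp_mul_abs_gaussian t

/-- Gaussian integration by parts on the half-line. -/
theorem integral_abs_sub_mul_exp_gaussian (t : ℝ) :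
    ∫ x, (|x| - t) * exp (t * |x|) ∂gaussianReal 0 1 = β₀ := by
  have hint : Integrable (fun x : ℝ => (|x| - t) * exp (t * |x|)) (gaussianReal 0 1) := by
    have h1 : Integrable (fun x : ℝ => |x| * exp (t * |x|)) (gaussianReal 0 1) := by
      have := integrable_pow_mul_exp_of_mem_interior_integrableExpSet
        (X := fun x : ℝ => |x|) (μ := gaussianReal 0 1) (v := t)
        (by simp [integrableExpSet_abs_gaussian]) 1
      simpa using this
    have := h1.sub ((integrable_exp_mul_abs_gaussian t).const_mul t)
    refine this.congr (ae_of_all _ fun x => ?_)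
    simp only [Pi.sub_apply]
    ring
  rw [gaussianReal_of_var_ne_zero 0 one_ne_zero] at hint
  have hint' := (integrable_withDensity_iff_integrable_smul' (measurable_gaussianPDF 0 1)
    (ae_of_all _ fun _ => gaussianPDF_lt_top)).1 hint
  rw [integral_gaussianReal_eq_integral_smul one_ne_zero]
  simp only [toReal_gaussianPDF, smul_eq_mul] at hint' ⊢
  -- Up to sign and a constant, `F` is the derivative of exp(tx - x²/2). The integrand is even, so
  -- its integral is twice the boundary value at 0, namely 2/√(2π) = β₀.
  set F : ℝ → ℝ := fun x => (√(2 * π))⁻¹ * ((x - t) * exp (t * x - x ^ 2 / 2)) with hF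
  have hfun : ∀ x : ℝ, gaussianPDFReal 0 1 x * ((|x| - t) * exp (t * |x|)) = F |x| := by
    intro x
    simp only [hF, gaussianPDFReal, NNReal.coe_one, mul_one, sub_zero, sq_abs]
    rw [sub_eq_add_neg (t * |x|), exp_add, neg_div]
    ring
  simp_rw [hfun] at hint' ⊢
  rw [integral_comp_abs]
  have hFint : IntegrableOn F (Set.Ioi 0) := by
    refine (hint'.integrableOn (s := Set.Ioi 0)).congr_fun (fun x hx => ?_) measurableSet_Ioi
    simp only [abs_of_pos (Set.mem_Ioi.1 hx)]
  have hderiv : ∀ x : ℝ, HasDerivAt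
      (fun x => -(√(2 * π))⁻¹ * exp (t * x - x ^ 2 / 2)) (F x) x := by
    intro x
    have h1 : HasDerivAt (fun x : ℝ => t * x - x ^ 2 / 2) (t - x) x := by
      have := ((hasDerivAt_id x).const_mul t).sub (((hasDerivAt_id x).pow 2).div_const 2)
      refine this.congr_deriv ?_
      simp
    refine (h1.exp.const_mul (-(√(2 * π))⁻¹)).congr_deriv ?_
    simp only [hF]
    ring
  have hlim : Tendsto (fun x : ℝ => -(√(2 * π))⁻¹ * exp (t * x - x ^ 2 / 2)) atTop (𝓝 0) := by
    rw [← mul_zero (-(√(2 * π))⁻¹)]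
    refine Tendsto.const_mul _ (tendsto_exp_atBot.comp ?_)
    have h1 : Tendsto (fun x : ℝ => x * (t - x / 2)) atTop atBot := by
      refine tendsto_id.atTop_mul_atBot₀ ?_
      refine tendsto_atBot_add_const_left _ t ?_
      exact tendsto_neg_atTop_atBot.comp (tendsto_id.atTop_div_const two_pos)
    refine h1.congr fun x => ?_
    ring
  rw [integral_Ioi_of_hasDerivAt_of_tendsto (hderiv 0).continuousAt.continuousWithinAt
    (fun x _ => hderiv x) hFint hlim, β₀]
  have h2 : (2 : ℝ) / π = 2 ^ 2 / (2 * π) := by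
    field_simp
  rw [h2, sqrt_div (by positivity), sqrt_sq (by norm_num)]
  simp
  field_simp

/-- Integration by parts gives the differential equation M' = β₀ + tM. Hence K = log M - (tβ₀ +
t²/2) has derivative β₀(1/M - 1); as M increases through M(0) = 1, K attains its maximum K(0) = 0 at
the origin. -/
theorem mgf_abs_gaussian_le (t : ℝ) :
    mgf (fun x : ℝ => |x|) (gaussianReal 0 1) t ≤ exp (t * β₀ + t ^ 2 / 2) := by
  set M := mgf (fun x : ℝ => |x|) (gaussianReal 0 1) with hM
  have hmem : ∀ t, t ∈ interior (integrableExpSet (fun x : ℝ => |x|) (gaussianReal 0 1)) := by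
    simp [integrableExpSet_abs_gaussian]
  have hpos : ∀ t, 0 < M t := fun t => mgf_pos (integrable_exp_mul_abs_gaussian t)
  have hderiv : ∀ t, HasDerivAt M (β₀ + t * M t) t := by
    intro t
    convert hasDerivAt_mgf (hmem t) using 1
    rw [← integral_abs_sub_mul_exp_gaussian t, hM, mgf, ← integral_const_mul, ← integral_add]
    · congr 1 with x
      ring
    · have h1 := integrable_pow_mul_exp_of_mem_interior_integrableExpSet (hmem t) 1
      have := h1.sub ((integrable_exp_mul_abs_gaussian t).const_mul t)
      refine this.congr (ae_of_all _ fun x => ?_)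
      simp only [Pi.sub_apply]
      ring
    · exact (integrable_exp_mul_abs_gaussian t).const_mul t
  have hM0 : M 0 = 1 := by simp [hM]
  have hmono : Monotone M := by
    intro a b hab
    refine integral_mono (integrable_exp_mul_abs_gaussian a) (integrable_exp_mul_abs_gaussian b) ?_
    intro x
    exact exp_le_exp.2 (mul_le_mul_of_nonneg_right hab (abs_nonneg x))
  set K : ℝ → ℝ := fun t => log (M t) - (t * β₀ + t ^ 2 / 2) with hK
  have hβ : 0 ≤ β₀ := sqrt_nonneg _
  have hKd : ∀ t, HasDerivAt K (β₀ * ((M t)⁻¹ - 1)) t := by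
    intro t
    have h1 : HasDerivAt (fun t : ℝ => t * β₀ + t ^ 2 / 2) (β₀ + t) t := by
      have := ((hasDerivAt_id t).mul_const β₀).add (((hasDerivAt_id t).pow 2).div_const 2)
      refine this.congr_deriv ?_
      simp
    refine (((hderiv t).log (hpos t).ne').sub h1).congr_deriv ?_
    have := (hpos t).ne'
    field_simp
    ring
  have hdiff : Differentiable ℝ K := fun t => (hKd t).differentiableAt
  have hK0 : K 0 = 0 := by simp [hK, hM0]
  have key : K t ≤ 0 := by
    rw [← hK0]
    rcases le_total 0 t with ht | ht
    · refine antitoneOn_of_deriv_nonpos (convex_Ici 0) hdiff.continuous.continuousOn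
        hdiff.differentiableOn (fun x hx => ?_) (Set.mem_Ici.2 le_rfl) ht ht
      rw [(hKd x).deriv]
      rw [interior_Ici] at hx
      have h1 : 1 ≤ M x := hM0 ▸ hmono (le_of_lt hx)
      exact mul_nonpos_of_nonneg_of_nonpos hβ (sub_nonpos.2 (inv_le_one_of_one_le₀ h1))
    · refine monotoneOn_of_deriv_nonneg (convex_Iic 0) hdiff.continuous.continuousOn
        hdiff.differentiableOn (fun x hx => ?_) ht (Set.mem_Iic.2 le_rfl) ht
      rw [(hKd x).deriv]
      rw [interior_Iic] at hx
      have h1 : M x ≤ 1 := hM0 ▸ hmono (le_of_lt hx)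
      exact mul_nonneg hβ (sub_nonneg.2 ((one_le_inv₀ (hpos x)).2 h1))
  rw [← log_le_iff_le_exp (hpos t)]
  simpa [hK] using key

/-- The absolute value of a centred Gaussian variable is subgaussian about its mean. -/
theorem lintegral_exp_mul_abs_le {Ω : Type*} [MeasurableSpace Ω] {P : Measure Ω} {Z : Ω → ℝ}
    {σ : ℝ} (hσ : 0 ≤ σ) (hZ : HasLaw Z (gaussianReal 0 (σ ^ 2).toNNReal) P) (t : ℝ) :
    ∫⁻ ω, ENNReal.ofReal (exp (t * |Z ω|)) ∂P ≤
      ENNReal.ofReal (exp (t * β₀ * σ + t ^ 2 * σ ^ 2 / 2)) := by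
  have hmeas : Measurable fun z : ℝ => ENNReal.ofReal (exp (t * |z|)) := by fun_prop
  have hmap : (gaussianReal 0 1).map (fun x => σ * x) = gaussianReal 0 (σ ^ 2).toNNReal := by
    rw [gaussianReal_map_const_mul]
    congr 1
    · simp
    · ext
      simp [sq_nonneg]
  rw [hZ.lintegral_comp hmeas.aemeasurable, ← hmap, lintegral_map hmeas (by fun_prop)]
  have h1 : ∀ x : ℝ, t * |σ * x| = t * σ * |x| := fun x => by
    rw [abs_mul, abs_of_nonneg hσ, mul_assoc]
  simp_rw [h1]
  rw [← ofReal_integral_eq_lintegral_ofReal (integrable_exp_mul_abs_gaussian _)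
    (ae_of_all _ fun _ => (exp_pos _).le)]
  refine ENNReal.ofReal_le_ofReal ((mgf_abs_gaussian_le (t * σ)).trans_eq ?_)
  congr 1
  ring

end

/-! ### Sampling without replacement: Maclaurin and Hoeffding. -/

/-- Homogeneous Bernoulli inequality, valid also at u = 0; it drives the induction in Maclaurin's
inequality. -/
theorem pow_add_mul_pow_mul_le_add_pow {u y : ℝ} (hu : 0 ≤ u) (huy : 0 ≤ u + y) (d : ℕ) :
    u ^ (d + 1) + (d + 1) * u ^ d * y ≤ (u + y) ^ (d + 1) := by
  induction d with
  | zero => simp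
  | succ d ih =>
    have h1 := mul_le_mul_of_nonneg_left ih huy
    have h2 : 0 ≤ (d + 1) * u ^ d * y ^ 2 := by positivity
    push_cast
    calc _ ≤ (u + y) * (u ^ (d + 1) + (d + 1) * u ^ d * y) := by
          rw [← sub_nonneg]
          convert h2 using 1
          ring
      _ ≤ (u + y) * (u + y) ^ (d + 1) := h1
      _ = _ := by ring

/-- Maclaurin's inequality between an elementary symmetric mean and the arithmetic mean. -/
theorem sum_powersetCard_prod_le {ι : Type*} [DecidableEq ι] (a : ι → ℝ) (J : Finset ι)
    (ha : ∀ j ∈ J, 0 ≤ a j) (d : ℕ) :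
    ∑ T ∈ J.powersetCard d, ∏ j ∈ T, a j ≤
      (J.card.choose d : ℝ) * ((∑ j ∈ J, a j) / J.card) ^ d := by
  induction J using Finset.induction_on generalizing d with
  | empty =>
    cases d with
    | zero => simp
    | succ d => simp [Finset.powersetCard_eq_empty.2 (show (∅ : Finset ι).card < d + 1 by simp)]
  | insert i J hi ih =>
    cases d with
    | zero => simp
    | succ d =>
      have hJ : ∀ j ∈ J, 0 ≤ a j := fun j hj => ha j (Finset.mem_insert_of_mem hj)
      have hai : 0 ≤ a i := ha i (Finset.mem_insert_self i J)
      have hdisj : Disjoint (J.powersetCard (d + 1)) ((J.powersetCard d).image (insert i)) := by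
        rw [Finset.disjoint_left]
        intro T hT hT'
        obtain ⟨U, -, rfl⟩ := Finset.mem_image.1 hT'
        exact hi ((Finset.mem_powersetCard.1 hT).1 (Finset.mem_insert_self i U))
      have hnot : ∀ U ∈ J.powersetCard d, i ∉ U := fun U hU h =>
        hi ((Finset.mem_powersetCard.1 hU).1 h)
      have himg : ∑ T ∈ (J.powersetCard d).image (insert i), ∏ j ∈ T, a j =
          a i * ∑ T ∈ J.powersetCard d, ∏ j ∈ T, a j := by
        rw [Finset.sum_image, Finset.mul_sum]
        · exact Finset.sum_congr rfl fun U hU => Finset.prod_insert (hnot U hU)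
        · intro U hU V hV h
          rw [← Finset.erase_insert (hnot U hU), h, Finset.erase_insert (hnot V hV)]
      rw [Finset.powersetCard_succ_insert hi, Finset.sum_union hdisj, himg,
        Finset.sum_insert hi, Finset.card_insert_of_notMem hi]
      set m := J.card with hm
      set S := ∑ j ∈ J, a j with hS
      have hS0 : 0 ≤ S := Finset.sum_nonneg hJ
      set u := S / m with hu
      have hu0 : 0 ≤ u := by positivity
      have hmu : (m : ℝ) * u = S := by
        rcases Nat.eq_zero_or_pos m with h | h
        · have : J = ∅ := Finset.card_eq_zero.1 (hm ▸ h)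
          simp [h, hS, this]
        · rw [hu]
          field_simp
      -- The change of the arithmetic mean when `a i` joins `J`. Bernoulli's inequality at this `y`
      -- matches the Pascal splitting by whether `i` is chosen.
      set y := (a i - u) / (m + 1) with hy
      have hm1 : (m : ℝ) + 1 ≠ 0 := by positivity
      have huy : (a i + S) / ((m + 1 : ℕ) : ℝ) = u + y := by
        rw [hy, ← hmu]
        push_cast
        field_simp
        ring
      have hc1 : ((m + 1).choose (d + 1) : ℝ) = m.choose d + m.choose (d + 1) := by
        rw [Nat.choose_succ_succ]
        push_cast
        ring
      have hc2 : ((m : ℝ) + 1) * m.choose d = (m + 1).choose (d + 1) * (d + 1) := by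
        exact_mod_cast Nat.add_one_mul_choose_eq m d
      have hbern := pow_add_mul_pow_mul_le_add_pow hu0 (y := y)
        (by rw [← huy]; positivity) d
      rw [huy]
      calc _ ≤ (m.choose (d + 1) : ℝ) * u ^ (d + 1) + a i * (m.choose d * u ^ d) :=
            add_le_add (ih hJ (d + 1)) (mul_le_mul_of_nonneg_left (ih hJ d) hai)
        _ = ((m + 1).choose (d + 1) : ℝ) * (u ^ (d + 1) + (d + 1) * u ^ d * y) := by
            have h3 : (m.choose (d + 1) : ℝ) = (m + 1).choose (d + 1) - m.choose d := by
              rw [hc1]; ring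
            have h4 : ((m + 1).choose (d + 1) : ℝ) * ((d + 1) * u ^ d * y)
                = m.choose d * u ^ d * (a i - u) := by
              rw [hy]
              calc _ = ((m + 1).choose (d + 1) * (d + 1) : ℝ) * u ^ d * (a i - u) / (m + 1) := by
                    ring
                _ = _ := by
                    rw [← hc2]
                    field_simp
            rw [mul_add, h4, h3]
            ring
        _ ≤ _ := mul_le_mul_of_nonneg_left hbern (by positivity)

/-- A form of Hoeffding's lemma for the uniform distribution on a finite set. -/
theorem sum_exp_div_card_le {ι : Type*} [Fintype ι] [Nonempty ι] (w : ι → ℝ) {c : ℝ}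
    (h0 : ∀ j, 0 ≤ w j) (hc : ∀ j, w j ≤ c) (t : ℝ) :
    (∑ j, Real.exp (t * w j)) / Fintype.card ι ≤
      Real.exp (t * ((∑ j, w j) / Fintype.card ι) + t ^ 2 * c ^ 2 / 2) := by
  set N : ℝ := (Fintype.card ι : ℝ) with hN
  have hNpos : 0 < N := by simp [hN, Fintype.card_pos]
  -- Symmetrization: Jensen lets the centring be replaced by an independent copy, and the difference
  -- of the two copies is handled through cosh z ≤ exp(z²/2).
  have hjensen : Real.exp (-t * ((∑ j, w j) / N)) ≤ (∑ j, Real.exp (-t * w j)) / N := by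
    have := convexOn_exp.map_sum_le (t := Finset.univ) (w := fun _ : ι => N⁻¹)
      (p := fun j => -t * w j) (fun _ _ => by positivity) (by simp [hN]) (fun _ _ => trivial)
    simp only [smul_eq_mul, ← Finset.mul_sum] at this
    calc _ = Real.exp (N⁻¹ * (-t * ∑ j, w j)) := by
          congr 1
          ring
      _ ≤ _ := this
      _ = _ := by ring
  have hpair : (∑ j, Real.exp (t * w j)) * ∑ j, Real.exp (-t * w j) ≤
      N ^ 2 * Real.exp (t ^ 2 * c ^ 2 / 2) := by
    have hcosh : ∀ i j, Real.exp (t * w i) * Real.exp (-t * w j)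
        + Real.exp (t * w j) * Real.exp (-t * w i) ≤ 2 * Real.exp (t ^ 2 * c ^ 2 / 2) := by
      intro i j
      have h1 := Real.cosh_le_exp_half_sq (t * (w i - w j))
      have h2 : (w i - w j) ^ 2 ≤ c ^ 2 := by
        apply sq_le_sq'
        · linarith [h0 i, hc j]
        · linarith [h0 j, hc i]
      have h3 : Real.exp ((t * (w i - w j)) ^ 2 / 2) ≤ Real.exp (t ^ 2 * c ^ 2 / 2) := by
        apply Real.exp_le_exp.2
        rw [mul_pow]
        have := mul_le_mul_of_nonneg_left h2 (sq_nonneg t)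
        linarith
      rw [Real.cosh_eq] at h1
      rw [← Real.exp_add, ← Real.exp_add]
      have e1 : t * w i + -t * w j = t * (w i - w j) := by ring
      have e2 : t * w j + -t * w i = -(t * (w i - w j)) := by ring
      rw [e1, e2]
      linarith
    have hsum : 2 * ((∑ j, Real.exp (t * w j)) * ∑ j, Real.exp (-t * w j)) =
        ∑ i, ∑ j, (Real.exp (t * w i) * Real.exp (-t * w j)
          + Real.exp (t * w j) * Real.exp (-t * w i)) := by
      simp_rw [Finset.sum_add_distrib]
      rw [two_mul]
      congr 1
      · rw [Finset.sum_mul_sum]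
      · rw [Finset.sum_comm, Finset.sum_mul_sum]
    have hle : ∑ i, ∑ j, (Real.exp (t * w i) * Real.exp (-t * w j)
          + Real.exp (t * w j) * Real.exp (-t * w i)) ≤
        ∑ _i : ι, ∑ _j : ι, 2 * Real.exp (t ^ 2 * c ^ 2 / 2) :=
      Finset.sum_le_sum fun i _ => Finset.sum_le_sum fun j _ => hcosh i j
    simp only [Finset.sum_const, Finset.card_univ, nsmul_eq_mul, ← hN] at hle
    nlinarith
  have hpos : 0 ≤ ∑ j, Real.exp (t * w j) := Finset.sum_nonneg fun _ _ => (Real.exp_pos _).le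
  rw [Real.exp_add]
  have hinv : Real.exp (t * ((∑ j, w j) / N)) * Real.exp (-t * ((∑ j, w j) / N)) = 1 := by
    rw [← Real.exp_add]
    simp
  calc (∑ j, Real.exp (t * w j)) / N
      = Real.exp (t * ((∑ j, w j) / N)) *
          ((∑ j, Real.exp (t * w j)) / N * Real.exp (-t * ((∑ j, w j) / N))) := by
        rw [mul_left_comm, hinv, mul_one]
    _ ≤ Real.exp (t * ((∑ j, w j) / N)) *
          ((∑ j, Real.exp (t * w j)) / N * ((∑ j, Real.exp (-t * w j)) / N)) := by
        gcongr
    _ = Real.exp (t * ((∑ j, w j) / N)) *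
          (((∑ j, Real.exp (t * w j)) * ∑ j, Real.exp (-t * w j)) / N ^ 2) := by
        congr 1
        field_simp
    _ ≤ _ := by
        gcongr
        rw [div_le_iff₀ (by positivity)]
        linarith

/-- The indicator vector of a set of rows. -/
def rowIndicator {m : ℕ} (T : Finset (Fin m)) (j : Fin m) : ℝ := if j ∈ T then 1 else 0

theorem rowIndicator_injective {m : ℕ} : Function.Injective (rowIndicator (m := m)) := by
  intro T U h
  ext j
  have := congrFun h j
  by_cases h1 : j ∈ T <;> by_cases h2 : j ∈ U <;> simp_all [rowIndicator]

theorem binaryColumns_eq_image (m d : ℕ) :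
    binaryColumns m d =
      (((Finset.univ : Finset (Fin m)).powersetCard d).map
        ⟨rowIndicator, rowIndicator_injective⟩ : Set (Fin m → ℝ)) := by
  classical
  ext v
  simp only [binaryColumns, Set.mem_ofPred_eq, Finset.coe_map, Function.Embedding.coeFn_mk,
    Set.mem_image, Finset.mem_coe, Finset.mem_powersetCard, Finset.subset_univ, true_and]
  constructor
  · rintro ⟨h01, hcard⟩
    refine ⟨Finset.univ.filter fun j => v j = 1, ?_, ?_⟩
    · rw [← hcard, Set.ncard_eq_toFinset_card']
      simp
    · ext j
      rcases h01 j with h | h <;> simp [rowIndicator, h]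
  · rintro ⟨T, hT, rfl⟩
    constructor
    · intro j
      by_cases h : j ∈ T <;> simp [rowIndicator, h]
    · rw [← hT]
      have : {j | rowIndicator T j = 1} = (T : Set (Fin m)) := by
        ext j
        by_cases h : j ∈ T <;> simp [rowIndicator, h]
      rw [this, Set.ncard_coe_finset]

theorem lintegral_uniformOn_finset {α : Type*} [MeasurableSpace α] [MeasurableSingletonClass α]
    (S : Finset α) (f : α → ENNReal) :
    ∫⁻ v, f v ∂uniformOn (S : Set α) = (S.card : ENNReal)⁻¹ * ∑ v ∈ S, f v := by
  rw [uniformOn, ProbabilityTheory.cond, lintegral_smul_measure, lintegral_finset, Measure.count_apply_finset]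
  simp

/-- A uniformly distributed binary column with a fixed number of ones is subgaussian. -/
theorem lintegral_exp_uniformOn_binaryColumns_le {m d : ℕ} (hm : 0 < m) (hd : d ≤ m)
    (w : Fin m → ℝ) {c : ℝ} (h0 : ∀ j, 0 ≤ w j) (hc : ∀ j, w j ≤ c) (t : ℝ) :
    ∫⁻ v, ENNReal.ofReal (Real.exp (t * ∑ j, v j * w j)) ∂uniformOn (binaryColumns m d) ≤
      ENNReal.ofReal (Real.exp (t * ((d : ℝ) / m * ∑ j, w j) + t ^ 2 * (d * c ^ 2) / 2)) := by
  classical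
  have : Nonempty (Fin m) := ⟨⟨0, hm⟩⟩
  rw [binaryColumns_eq_image, lintegral_uniformOn_finset, Finset.sum_map,
    ← ENNReal.ofReal_sum_of_nonneg (fun _ _ => (Real.exp_pos _).le), Finset.card_map,
    Finset.card_powersetCard, Finset.card_univ, Fintype.card_fin]
  have hprod : ∀ T : Finset (Fin m),
      Real.exp (t * ∑ j, rowIndicator T j * w j) = ∏ j ∈ T, Real.exp (t * w j) := by
    intro T
    rw [← Real.exp_sum, Finset.mul_sum]
    simp [rowIndicator, Finset.sum_ite_mem]
  have hch : 0 < (m.choose d : ℝ) := by exact_mod_cast Nat.choose_pos hd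
  simp only [Function.Embedding.coeFn_mk, hprod]
  rw [← ENNReal.ofReal_natCast, ← ENNReal.ofReal_inv_of_pos hch,
    ← ENNReal.ofReal_mul (by positivity)]
  apply ENNReal.ofReal_le_ofReal
  have h1 := sum_powersetCard_prod_le (fun j => Real.exp (t * w j)) Finset.univ
    (fun _ _ => (Real.exp_pos _).le) d
  have h2 := sum_exp_div_card_le w h0 hc t
  rw [Finset.card_univ, Fintype.card_fin] at h1
  rw [Fintype.card_fin] at h2
  rw [inv_mul_le_iff₀ hch]
  refine h1.trans (mul_le_mul_of_nonneg_left ?_ hch.le)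
  calc _ ≤ Real.exp (t * ((∑ j, w j) / m) + t ^ 2 * c ^ 2 / 2) ^ d := by
        gcongr
    _ = _ := by
        rw [← Real.exp_nat_mul]
        congr 1
        ring

/-! ### Bernoulli selectors and the mean of a row norm. -/

/-- The expectation of `f` under independent Bernoulli variables of parameter `p`. -/
noncomputable def bernoulliMean {ι : Type*} [Fintype ι] (p : ℝ) (f : (ι → Bool) → ℝ) : ℝ :=
  open scoped Classical in
  ∑ ξ, (∏ k, if ξ k then p else 1 - p) * f ξ

section

variable {ι : Type*} [Fintype ι] {p : ℝ}

theorem bernoulliMean_eq_sum [DecidableEq ι] (f : (ι → Bool) → ℝ) :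
    bernoulliMean p f = ∑ ξ, (∏ k, if ξ k then p else 1 - p) * f ξ :=
  Finset.sum_congr (by ext; simp) fun _ _ => rfl

theorem bernoulliMean_mono (h0 : 0 ≤ p) (h1 : p ≤ 1) {f g : (ι → Bool) → ℝ}
    (h : ∀ ξ, f ξ ≤ g ξ) : bernoulliMean p f ≤ bernoulliMean p g := by
  refine Finset.sum_le_sum fun ξ _ => mul_le_mul_of_nonneg_left (h ξ) ?_
  refine Finset.prod_nonneg fun k _ => ?_
  split_ifs <;> linarith

theorem bernoulliMean_add (f g : (ι → Bool) → ℝ) :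
    bernoulliMean p (fun ξ => f ξ + g ξ) = bernoulliMean p f + bernoulliMean p g := by
  simp only [bernoulliMean, mul_add, Finset.sum_add_distrib]

theorem bernoulliMean_const_mul (c : ℝ) (f : (ι → Bool) → ℝ) :
    bernoulliMean p (fun ξ => c * f ξ) = c * bernoulliMean p f := by
  simp only [bernoulliMean, Finset.mul_sum]
  exact Finset.sum_congr rfl fun ξ _ => by ring

theorem bernoulliMean_sum {κ : Type*} (K : Finset κ) (f : κ → (ι → Bool) → ℝ) :
    bernoulliMean p (fun ξ => ∑ k ∈ K, f k ξ) = ∑ k ∈ K, bernoulliMean p (f k) := by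
  simp only [bernoulliMean, Finset.mul_sum]
  exact Finset.sum_comm

theorem bernoulliMean_prod (g : ι → Bool → ℝ) :
    bernoulliMean p (fun ξ => ∏ k, g k (ξ k)) = ∏ k, (p * g k true + (1 - p) * g k false) := by
  classical
  have := Finset.prod_univ_sum (fun _ : ι => (Finset.univ : Finset Bool))
    (fun k b => (if b then p else 1 - p) * g k b)
  simp only [Fintype.sum_bool, Fintype.piFinset_univ, if_true, Bool.false_eq_true, if_false]
    at this
  rw [this, bernoulliMean_eq_sum]
  exact Finset.sum_congr rfl fun ξ _ => by rw [Finset.prod_mul_distrib]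

theorem bernoulliMean_const (c : ℝ) : bernoulliMean p (fun _ : ι → Bool => c) = c := by
  have h := bernoulliMean_prod (p := p) (fun (_ : ι) _ => 1)
  simp only [Finset.prod_const_one, mul_one, add_sub_cancel] at h
  have h2 := bernoulliMean_const_mul (p := p) c (fun _ : ι → Bool => 1)
  rw [h] at h2
  simpa using h2

theorem bernoulliMean_comp_equiv {κ : Type*} [Fintype κ] (e : κ ≃ ι) (f : (κ → Bool) → ℝ) :
    bernoulliMean p (fun ξ : ι → Bool => f (ξ ∘ e)) = bernoulliMean p f := by
  classical
  rw [bernoulliMean_eq_sum, bernoulliMean_eq_sum]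
  refine Fintype.sum_equiv (e.arrowCongr (Equiv.refl Bool)).symm _ _ fun ξ => ?_
  have h1 : (e.arrowCongr (Equiv.refl Bool)).symm ξ = ξ ∘ e := by
    ext
    simp
  rw [h1, ← Equiv.prod_comp e]
  rfl

theorem bernoulliMean_succ {n : ℕ} (f : (Fin (n + 1) → Bool) → ℝ) :
    bernoulliMean p f = p * bernoulliMean p (fun ξ => f (Fin.cons true ξ)) +
      (1 - p) * bernoulliMean p (fun ξ => f (Fin.cons false ξ)) := by
  classical
  have h : bernoulliMean p f = ∑ q : Bool × (Fin n → Bool),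
      (if q.1 then p else 1 - p) *
        ((∏ k, if q.2 k then p else 1 - p) * f (Fin.cons q.1 q.2)) := by
    rw [bernoulliMean_eq_sum]
    refine Fintype.sum_equiv (Fin.consEquiv fun _ => Bool).symm _ _ fun ξ => ?_
    rw [Fin.prod_univ_succ, mul_assoc]
    congr 3
    exact (Fin.cons_self_tail ξ).symm
  rw [h, Fintype.sum_prod_type, Fintype.sum_bool]
  simp only [bernoulliMean_eq_sum, Finset.mul_sum, if_true, Bool.false_eq_true, if_false]

end

/-- The mean of `√(t + ∑ k, ξ k * x k ^ 2)` for independent Bernoulli variables `ξ k`. -/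
noncomputable def sqrtMean (p : ℝ) {n : ℕ} (x : Fin n → ℝ) (t : ℝ) : ℝ :=
  bernoulliMean p fun ξ => √(t + ∑ k, if ξ k then x k ^ 2 else 0)

/-- Conditioning on the first selector only shifts the offset `t`; carrying the offset is what
closes the recursion. -/
theorem sqrtMean_succ (p : ℝ) {n : ℕ} (x : Fin (n + 1) → ℝ) (t : ℝ) :
    sqrtMean p x t =
      p * sqrtMean p (Fin.tail x) (t + x 0 ^ 2) + (1 - p) * sqrtMean p (Fin.tail x) t := by
  rw [sqrtMean, bernoulliMean_succ]
  simp only [Fin.sum_univ_succ, Fin.cons_zero, Fin.cons_succ, if_true, Bool.false_eq_true,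
    if_false, zero_add, ← add_assoc]
  rfl

section

variable {p : ℝ} {n : ℕ} (x : Fin n → ℝ)

theorem sqrtMean_le_sqrtMean_add (h0 : 0 ≤ p) (h1 : p ≤ 1) (t a : ℝ) :
    sqrtMean p x t ≤ sqrtMean p x (t + a ^ 2) :=
  bernoulliMean_mono h0 h1 fun ξ => Real.sqrt_le_sqrt (by nlinarith [sq_nonneg a])

theorem sqrt_add_sq_le {t : ℝ} (ht : 0 ≤ t) (a : ℝ) : √(t + a ^ 2) ≤ √t + |a| := by
  rw [Real.sqrt_le_left (by positivity), add_sq, Real.sq_sqrt ht, sq_abs]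
  have : 0 ≤ 2 * √t * |a| := by positivity
  linarith

theorem sum_ite_sq_nonneg (ξ : Fin n → Bool) : 0 ≤ ∑ k, if ξ k then x k ^ 2 else 0 :=
  Finset.sum_nonneg fun k _ => by split_ifs <;> positivity

/-- Together with monotonicity in the offset, this confines the effect of one revealed entry to [0,
|a|], the range used in Hoeffding's lemma. -/
theorem sqrtMean_add_le (h0 : 0 ≤ p) (h1 : p ≤ 1) {t : ℝ} (ht : 0 ≤ t) (a : ℝ) :
    sqrtMean p x (t + a ^ 2) ≤ sqrtMean p x t + |a| := by
  rw [← bernoulliMean_const (ι := Fin n) (p := p) |a|, sqrtMean, sqrtMean, ← bernoulliMean_add]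
  refine bernoulliMean_mono h0 h1 fun ξ => ?_
  rw [add_right_comm]
  exact sqrt_add_sq_le (add_nonneg ht (sum_ite_sq_nonneg x ξ)) a

end

/-! ### Concentration of the sum of row norms over the binary matrix. -/

theorem isProbabilityMeasure_uniformOn_binaryColumns {m d : ℕ} (hd : d ≤ m) :
    IsProbabilityMeasure (uniformOn (binaryColumns m d)) := by
  rw [binaryColumns_eq_image]
  refine isProbabilityMeasure_uniformOn (Finset.finite_toSet _) ?_
  simpa [Finset.powersetCard_nonempty] using hd

theorem ae_mem_binaryColumns {m d : ℕ} :
    ∀ᵐ v ∂uniformOn (binaryColumns m d), v ∈ binaryColumns m d := by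
  refine ae_cond_mem ?_
  rw [binaryColumns_eq_image]
  exact (Finset.finite_toSet _).measurableSet

/-- The sum of the Euclidean norms of the weighted rows of a random binary matrix is subgaussian
about its mean. -/
theorem lintegral_exp_sum_sqrt_le {m d : ℕ} (hm : 0 < m) (hd : d ≤ m) (t : ℝ) {n : ℕ}
    (x : Fin n → ℝ) (τ : Fin m → ℝ) (hτ : ∀ j, 0 ≤ τ j) :
    ∫⁻ v, ENNReal.ofReal (Real.exp (t * ∑ j, √(τ j + ∑ k, v k j * x k ^ 2)))
        ∂Measure.pi (fun _ : Fin n => uniformOn (binaryColumns m d)) ≤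
      ENNReal.ofReal (Real.exp (t * ∑ j, sqrtMean ((d : ℝ) / m) x (τ j)
        + t ^ 2 * (d * ∑ k, x k ^ 2) / 2)) := by
  have := isProbabilityMeasure_uniformOn_binaryColumns hd
  set ν := uniformOn (binaryColumns m d) with hν
  have hm' : (0 : ℝ) < m := by exact_mod_cast hm
  have hp0 : 0 ≤ (d : ℝ) / m := by positivity
  have hp1 : (d : ℝ) / m ≤ 1 := (div_le_one hm').2 (by exact_mod_cast hd)
  set p := (d : ℝ) / m with hp
  -- The offsets `τ` store the contribution of the columns already revealed, hence must vary from
  -- row to row.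
  induction n generalizing τ with
  | zero =>
    simp [sqrtMean, bernoulliMean_const]
  | succ n ih =>
    have hmp := (measurePreserving_piFinSuccAbove (fun _ : Fin (n + 1) => ν) 0).symm
    rw [← hmp.lintegral_comp_emb (MeasurableEquiv.measurableEmbedding _),
      lintegral_prod _ (by fun_prop)]
    set w : Fin m → ℝ := fun j =>
      sqrtMean p (Fin.tail x) (τ j + x 0 ^ 2) - sqrtMean p (Fin.tail x) (τ j) with hw
    set C : ℝ := t * ∑ j, sqrtMean p (Fin.tail x) (τ j)
      + t ^ 2 * (d * ∑ k, Fin.tail x k ^ 2) / 2 with hC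
    have hinner : ∀ v ∈ binaryColumns m d,
        ∫⁻ r, ENNReal.ofReal (Real.exp (t * ∑ j, √(τ j + ∑ k : Fin (n + 1),
          (Fin.insertNth 0 v r : Fin (n + 1) → Fin m → ℝ) k j * x k ^ 2)))
          ∂Measure.pi (fun _ : Fin n => ν) ≤
        ENNReal.ofReal (Real.exp C) * ENNReal.ofReal (Real.exp (t * ∑ j, v j * w j)) := by
      intro v hv
      have hv01 : ∀ j, v j = 0 ∨ v j = 1 := hv.1
      refine le_trans (le_of_eq ?_) ((ih (Fin.tail x) (fun j => τ j + v j * x 0 ^ 2) ?_).trans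
        (le_of_eq ?_))
      · simp only [Fin.sum_univ_succ, Fin.insertNth_zero', Fin.cons_zero, Fin.cons_succ,
          ← add_assoc]
        rfl
      · intro j
        rcases hv01 j with h | h <;> rw [h] <;> nlinarith [hτ j, sq_nonneg (x 0)]
      · rw [← ENNReal.ofReal_mul (Real.exp_pos _).le, ← Real.exp_add]
        congr 2
        -- Since `v j` is 0 or 1, the conditional mean is affine in it, so the column bound for
        -- linear functionals applies.
        have hj : ∀ j, sqrtMean p (Fin.tail x) (τ j + v j * x 0 ^ 2) =
            sqrtMean p (Fin.tail x) (τ j) + v j * w j := by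
          intro j
          rcases hv01 j with h | h <;> simp [h, hw]
        simp only [hj, Finset.sum_add_distrib, hC]
        ring
    have hmono : ∫⁻ v, ∫⁻ r, ENNReal.ofReal (Real.exp (t * ∑ j, √(τ j + ∑ k : Fin (n + 1),
          (Fin.insertNth 0 v r : Fin (n + 1) → Fin m → ℝ) k j * x k ^ 2)))
          ∂Measure.pi (fun _ : Fin n => ν) ∂ν ≤
        ∫⁻ v, ENNReal.ofReal (Real.exp C) * ENNReal.ofReal (Real.exp (t * ∑ j, v j * w j)) ∂ν :=
      lintegral_mono_ae (ae_mem_binaryColumns.mono hinner)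
    refine hmono.trans ?_
    rw [lintegral_const_mul _ (by fun_prop)]
    have hcol := lintegral_exp_uniformOn_binaryColumns_le hm hd w (c := |x 0|)
      (fun j => sub_nonneg.2 (sqrtMean_le_sqrtMean_add _ hp0 hp1 _ _))
      (fun j => sub_le_iff_le_add'.2 (sqrtMean_add_le _ hp0 hp1 (hτ j) _)) t
    refine (mul_le_mul_right hcol _).trans (le_of_eq ?_)
    rw [← ENNReal.ofReal_mul (Real.exp_pos _).le, ← Real.exp_add]
    congr 2
    have hj : ∀ j, sqrtMean p x (τ j) = sqrtMean p (Fin.tail x) (τ j) + p * w j := by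
      intro j
      rw [sqrtMean_succ, hw]
      ring
    simp only [hj, Finset.sum_add_distrib, hC, Fin.sum_univ_succ, ← Finset.mul_sum, sq_abs, Fin.tail, ← hp]
    ring

/-! ### Comparison of the mean row norm with the block norm. -/

theorem sum_range_mul_eq {M : Type*} [AddCommMonoid M] (F : ℕ → M) (L s : ℕ) :
    ∑ i ∈ Finset.range (L * s), F i =
      ∑ l ∈ Finset.range L, ∑ r ∈ Finset.range s, F (l * s + r) := by
  induction L with
  | zero => simp
  | succ L ih => rw [Nat.succ_mul, Finset.sum_range_add, ih, Finset.sum_range_succ]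

theorem le_ceilDiv_mul {n s : ℕ} (hs : 1 ≤ s) : n ≤ (n ⌈/⌉ s) * s := by
  have := (ceilDiv_le_iff_le_smul (a := s) (b := n) (c := n ⌈/⌉ s) hs).1 le_rfl
  rwa [smul_eq_mul, mul_comm] at this

/-- A sum over `Fin n` decomposes into sums over consecutive blocks of length `s`. -/
theorem sum_fin_eq_sum_blocks {M : Type*} [AddCommMonoid M] {n s : ℕ} (hs : 1 ≤ s) (F : ℕ → M)
    (hF : ∀ i, n ≤ i → F i = 0) :
    ∑ i : Fin n, F i =
      ∑ l ∈ Finset.range (n ⌈/⌉ s), ∑ r ∈ Finset.range s, F (l * s + r) := by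
  rw [← sum_range_mul_eq, Fin.sum_univ_eq_sum_range]
  refine Finset.sum_subset (Finset.range_mono (le_ceilDiv_mul hs)) fun i _ hi => hF i ?_
  simpa using hi

theorem sq_bernoulliMean_le {ι : Type*} [Fintype ι] {p : ℝ} (h0 : 0 ≤ p) (h1 : p ≤ 1)
    (f : (ι → Bool) → ℝ) :
    bernoulliMean p f ^ 2 ≤ bernoulliMean p fun ξ => f ξ ^ 2 := by
  set μ := bernoulliMean p f with hμ
  have h := bernoulliMean_mono h0 h1 (f := fun ξ => 2 * μ * f ξ + -(μ ^ 2))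
    (g := fun ξ => f ξ ^ 2) fun ξ => by nlinarith [sq_nonneg (f ξ - μ)]
  rw [bernoulliMean_add, bernoulliMean_const_mul, bernoulliMean_const, ← hμ] at h
  linarith

/-- The event constrains coordinates separately, so its indicator is a product of one-coordinate
functions. -/
theorem bernoulliMean_first {ι : Type*} [Fintype ι] [DecidableEq ι] {p : ℝ} (i : ι)
    (D : Finset ι) (hi : i ∉ D) :
    bernoulliMean p (fun ξ => if ξ i = true ∧ ∀ k ∈ D, ξ k = false then (1 : ℝ) else 0) =
      p * (1 - p) ^ D.card := by
  obtain ⟨g, hg⟩ : ∃ g : ι → Bool → ℝ, ∀ k b, g k b = if k = i then (if b then 1 else 0)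
      else if k ∈ D then (if b then 0 else 1) else 1 := ⟨_, fun _ _ => rfl⟩
  have hprod : ∀ ξ : ι → Bool,
      (if ξ i = true ∧ ∀ k ∈ D, ξ k = false then (1 : ℝ) else 0) = ∏ k, g k (ξ k) := by
    intro ξ
    simp only [hg]
    split_ifs with h
    · refine (Finset.prod_eq_one fun k _ => ?_).symm
      by_cases hk : k = i
      · simp [hk, h.1]
      · by_cases hkD : k ∈ D
        · simp [hk, hkD, h.2 k hkD]
        · simp [hk, hkD]
    · symm
      rw [not_and_or] at h
      rcases h with h | h
      · exact Finset.prod_eq_zero (Finset.mem_univ i) (by simp [h])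
      · push Not at h
        obtain ⟨k, hkD, hk⟩ := h
        have hki : k ≠ i := fun e => hi (e ▸ hkD)
        exact Finset.prod_eq_zero (Finset.mem_univ k) (by simp [hki, hkD, hk])
  simp_rw [hprod]
  rw [bernoulliMean_prod]
  calc _ = ∏ k, (if k = i then p else 1) * (if k ∈ D then 1 - p else 1) := by
        refine Finset.prod_congr rfl fun k _ => ?_
        rw [hg, hg]
        by_cases hk : k = i
        · simp [hk, hi]
        · by_cases hkD : k ∈ D <;> simp [hk, hkD]
    _ = _ := by
        rw [Finset.prod_mul_distrib, Finset.prod_ite_eq', Finset.prod_ite_mem]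
        simp

/-- At most one index is the first selected one, so the left side has at most one nonzero term, and
it also occurs on the right. -/
theorem sq_sum_first_le (c : ℕ → ℝ) (g : ℕ → Bool) (s : ℕ) :
    (∑ r ∈ Finset.range s, c r * if g r = true ∧ ∀ k < r, g k = false then (1 : ℝ) else 0) ^ 2 ≤
      ∑ r ∈ Finset.range s, if g r then c r ^ 2 else 0 := by
  induction s with
  | zero => simp
  | succ s ih =>
    rw [Finset.sum_range_succ, Finset.sum_range_succ]
    by_cases h : ∀ k < s, g k = false
    · rw [Finset.sum_eq_zero, Finset.sum_eq_zero]
      · cases hg : g s <;> simp +contextual [h]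
      · intro r hr
        simp [h r (Finset.mem_range.1 hr)]
      · intro r hr
        simp [h r (Finset.mem_range.1 hr)]
    · simp only [h, and_false, if_false, mul_zero, add_zero]
      have : 0 ≤ if g s = true then c s ^ 2 else 0 := by split_ifs <;> positivity
      linarith

section

variable {n s : ℕ} {α : ℕ → ℝ}

/-- The extension of a family indexed by `Fin n` to all natural numbers by `false`. -/
def extendFalse (ξ : Fin n → Bool) (i : ℕ) : Bool := if h : i < n then ξ ⟨i, h⟩ else false

theorem extendFalse_coe (ξ : Fin n → Bool) (i : Fin n) : extendFalse ξ i = ξ i := by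
  simp [extendFalse]

theorem sum_ite_sq_eq_sum_blocks (hs : 1 ≤ s) (hz : ∀ i, n ≤ i → α i = 0) (ξ : Fin n → Bool) :
    ∑ k : Fin n, (if ξ k then α k ^ 2 else 0) = ∑ l ∈ Finset.range (n ⌈/⌉ s),
      ∑ r ∈ Finset.range s, if extendFalse ξ (l * s + r) then α (l * s + r) ^ 2 else 0 := by
  rw [← sum_fin_eq_sum_blocks hs fun i => if extendFalse ξ i then α i ^ 2 else 0]
  · simp only [extendFalse_coe]
  · intro i hi
    simp [hz i hi]

/-- At most r positions precede the r-th one in its block, each unselected with probability 1 - p.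
The factor α makes positions beyond n harmless. -/
theorem le_bernoulliMean_sum_first {p : ℝ} (h0 : 0 ≤ p) (h1 : p ≤ 1) (hα0 : ∀ i, 0 ≤ α i)
    (hz : ∀ i, n ≤ i → α i = 0) (l r : ℕ) :
    α (l * s + r) * (p * (1 - p) ^ r) ≤ α (l * s + r) * bernoulliMean p (fun ξ : Fin n → Bool =>
      if extendFalse ξ (l * s + r) = true ∧ ∀ k < r, extendFalse ξ (l * s + k) = false
        then (1 : ℝ) else 0) := by
  by_cases hn : l * s + r < n
  · refine mul_le_mul_of_nonneg_left ?_ (hα0 _)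
    set D : Finset (Fin n) := Finset.univ.filter fun k => l * s ≤ k ∧ (k : ℕ) < l * s + r with hD
    have hiD : (⟨l * s + r, hn⟩ : Fin n) ∉ D := by simp [hD]
    have hcard : D.card ≤ r := by
      have h2 : (D.map Fin.valEmbedding) ⊆ Finset.Ico (l * s) (l * s + r) := by
        intro k hk
        obtain ⟨k', hk', rfl⟩ := Finset.mem_map.1 hk
        simpa [hD] using hk'
      simpa using Finset.card_le_card h2
    have heq : bernoulliMean p (fun ξ : Fin n → Bool => if extendFalse ξ (l * s + r) = true ∧
        ∀ k < r, extendFalse ξ (l * s + k) = false then (1 : ℝ) else 0) =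
        p * (1 - p) ^ D.card := by
      rw [← bernoulliMean_first _ _ hiD]
      congr 1
      ext ξ
      have hiff : (extendFalse ξ (l * s + r) = true ∧ ∀ k < r, extendFalse ξ (l * s + k) = false) ↔
          ξ ⟨l * s + r, hn⟩ = true ∧ ∀ k ∈ D, ξ k = false := by
        refine and_congr ?_ ⟨fun h k hk => ?_, fun h k hk => ?_⟩
        · simp [extendFalse, hn]
        · have hk' : l * s ≤ k ∧ (k : ℕ) < l * s + r := by simpa [hD] using hk
          have := h (k - l * s) (by omega)
          rwa [Nat.add_sub_cancel' hk'.1, extendFalse_coe] at this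
        · have hkn : l * s + k < n := by omega
          simpa [extendFalse, hkn] using h ⟨l * s + k, hkn⟩ (by simp [hD, hk])
      by_cases h : ξ ⟨l * s + r, hn⟩ = true ∧ ∀ k ∈ D, ξ k = false
      · rw [if_pos h, if_pos (hiff.2 h)]
      · rw [if_neg h, if_neg (mt hiff.1 h)]
    rw [heq]
    exact mul_le_mul_of_nonneg_left
      (pow_le_pow_of_le_one (by linarith) (by linarith) hcard) h0
  · simp [hz _ (not_lt.1 hn)]

/-- Chebyshev's sum inequality for two decreasing sequences; with ratio 1 - 1/s the geometric sum is
s(1 - (1 - 1/s)^s). -/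
theorem sum_mul_pow_ge (hs : 1 ≤ s) (hα : Antitone α) (l : ℕ) :
    (1 - (1 - 1 / (s : ℝ)) ^ s) * ∑ r ∈ Finset.range s, α (l * s + r) ≤
      ∑ r ∈ Finset.range s, α (l * s + r) * (1 - 1 / (s : ℝ)) ^ r := by
  have hs' : (1 : ℝ) ≤ s := by exact_mod_cast hs
  have hspos : (0 : ℝ) < s := by linarith
  set q := 1 - 1 / (s : ℝ) with hq
  have hq0 : 0 ≤ q := sub_nonneg.2 ((div_le_one hspos).2 hs')
  have hq1 : q ≤ 1 := by
    have : 0 ≤ 1 / (s : ℝ) := by positivity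
    linarith
  have hmono : MonovaryOn (fun r => α (l * s + r)) (fun r => q ^ r) (Finset.range s : Set ℕ) := by
    refine AntitoneOn.monovaryOn (Antitone.antitoneOn ?_ _) (Antitone.antitoneOn ?_ _)
    · exact fun a b hab => hα (Nat.add_le_add_left hab _)
    · exact fun a b hab => pow_le_pow_of_le_one hq0 hq1 hab
  have h := hmono.sum_mul_sum_le_card_mul_sum
  rw [Finset.card_range] at h
  have hgeom : ∑ r ∈ Finset.range s, q ^ r = s * (1 - q ^ s) := by
    have h2 := geom_sum_mul_neg q s
    have h3 : 1 - q = 1 / s := by rw [hq]; ring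
    rw [h3] at h2
    rw [← h2]
    field_simp
  rw [hgeom] at h
  refine le_of_mul_le_mul_left ?_ hspos
  linarith

theorem sqrtMean_ge (hs : 1 ≤ s) (hα : Antitone α) (hα0 : ∀ i, 0 ≤ α i)
    (hz : ∀ i, n ≤ i → α i = 0) :
    0.63 * √(∑ l ∈ Finset.range (n ⌈/⌉ s), (∑ r ∈ Finset.range s, α (l * s + r)) ^ 2) ≤
      s * sqrtMean (1 / (s : ℝ)) (fun i : Fin n => α i) 0 := by
  have hs' : (1 : ℝ) ≤ s := by exact_mod_cast hs
  have hspos : (0 : ℝ) < s := by linarith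
  have hp0 : 0 ≤ 1 / (s : ℝ) := by positivity
  have hp1 : 1 / (s : ℝ) ≤ 1 := (div_le_one hspos).2 hs'
  have hq : (1 - 1 / (s : ℝ)) ^ s ≤ 0.37 := by
    have h1 := Real.one_sub_div_pow_le_exp_neg (n := s) (t := 1) hs'
    have h2 := Real.exp_neg_one_lt_d9
    linarith
  set p := 1 / (s : ℝ) with hp
  set b : ℕ → ℝ := fun l => ∑ r ∈ Finset.range s, α (l * s + r) with hb
  have hb0 : ∀ l, 0 ≤ b l := fun l => Finset.sum_nonneg fun _ _ => hα0 _
  set η : ℕ → ℕ → (Fin n → Bool) → ℝ := fun l r ξ =>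
    if extendFalse ξ (l * s + r) = true ∧ ∀ k < r, extendFalse ξ (l * s + k) = false
      then (1 : ℝ) else 0 with hη
  set V : ℝ := ∑ l ∈ Finset.range (n ⌈/⌉ s), b l ^ 2 with hV
  have hV0 : 0 ≤ V := Finset.sum_nonneg fun _ _ => sq_nonneg _
  -- Cauchy–Schwarz over blocks. The left side is linear in the first-selection indicators, so its
  -- mean is computable.
  have hpoint : ∀ ξ : Fin n → Bool,
      ∑ l ∈ Finset.range (n ⌈/⌉ s), b l * ∑ r ∈ Finset.range s, α (l * s + r) * η l r ξ ≤
        √V * √(0 + ∑ k : Fin n, if ξ k then α k ^ 2 else 0) := by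
    intro ξ
    refine (Real.sum_mul_le_sqrt_mul_sqrt _ _ _).trans ?_
    refine mul_le_mul_of_nonneg_left (Real.sqrt_le_sqrt ?_) (Real.sqrt_nonneg _)
    rw [zero_add, sum_ite_sq_eq_sum_blocks hs hz]
    exact Finset.sum_le_sum fun l _ =>
      sq_sum_first_le (fun r => α (l * s + r)) (fun r => extendFalse ξ (l * s + r)) s
  have hmean := bernoulliMean_mono hp0 hp1 hpoint
  rw [bernoulliMean_const_mul, bernoulliMean_sum] at hmean
  simp only [bernoulliMean_const_mul, bernoulliMean_sum] at hmean
  have hblock : ∀ l, p * 0.63 * b l ≤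
      ∑ r ∈ Finset.range s, α (l * s + r) * bernoulliMean p (η l r) := by
    intro l
    calc p * 0.63 * b l ≤ p * ((1 - (1 - p) ^ s) * b l) := by
          rw [mul_assoc]
          gcongr
          · exact hb0 l
          · linarith
      _ ≤ p * ∑ r ∈ Finset.range s, α (l * s + r) * (1 - p) ^ r :=
          mul_le_mul_of_nonneg_left (sum_mul_pow_ge hs hα l) hp0
      _ = ∑ r ∈ Finset.range s, α (l * s + r) * (p * (1 - p) ^ r) := by
          rw [Finset.mul_sum]
          exact Finset.sum_congr rfl fun _ _ => by ring
      _ ≤ _ := Finset.sum_le_sum fun r _ => le_bernoulliMean_sum_first hp0 hp1 hα0 hz l r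
  have hlow : p * 0.63 * V ≤ √V * sqrtMean p (fun i : Fin n => α i) 0 := by
    refine le_trans ?_ hmean
    rw [hV, Finset.mul_sum]
    refine Finset.sum_le_sum fun l _ => ?_
    calc p * 0.63 * b l ^ 2 = b l * (p * 0.63 * b l) := by ring
      _ ≤ _ := mul_le_mul_of_nonneg_left (hblock l) (hb0 l)
  have hsp : (s : ℝ) * p = 1 := by rw [hp]; field_simp
  -- The case V = 0 is separate because the general one cancels a factor √V.
  rcases hV0.eq_or_lt with h | h
  · rw [← h, Real.sqrt_zero, mul_zero]
    refine mul_nonneg hspos.le ?_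
    rw [← bernoulliMean_const (ι := Fin n) (p := p) 0]
    exact bernoulliMean_mono hp0 hp1 fun _ => Real.sqrt_nonneg _
  · refine le_of_mul_le_mul_left ?_ (Real.sqrt_pos.2 h)
    calc √V * (0.63 * √V) = s * p * (0.63 * (√V * √V)) := by rw [hsp]; ring
      _ = s * (p * 0.63 * V) := by rw [Real.mul_self_sqrt hV0]; ring
      _ ≤ s * (√V * sqrtMean p (fun i : Fin n => α i) 0) :=
          mul_le_mul_of_nonneg_left hlow hspos.le
      _ = _ := by ring

theorem sqrt_add_le_sqrt_add_sqrt {u v : ℝ} (hu : 0 ≤ u) (hv : 0 ≤ v) : √(u + v) ≤ √u + √v := by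
  simpa [Real.sq_sqrt hv, abs_of_nonneg (Real.sqrt_nonneg v)] using sqrt_add_sq_le hu √v

theorem sqrt_sum_ite_sq_le {ι : Type*} (K : Finset ι) (ξ : ι → Bool) {a : ι → ℝ}
    (ha : ∀ i, 0 ≤ a i) :
    √(∑ k ∈ K, if ξ k then a k ^ 2 else 0) ≤ ∑ k ∈ K, if ξ k then a k else 0 := by
  have h0 : ∀ k, 0 ≤ if ξ k then a k else 0 := fun k => by split_ifs <;> simp [ha]
  rw [Real.sqrt_le_left (Finset.sum_nonneg fun k _ => h0 k)]
  calc _ = ∑ k ∈ K, (if ξ k then a k else 0) ^ 2 :=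
        Finset.sum_congr rfl fun k _ => by split_ifs <;> simp
    _ ≤ _ := Finset.sum_sq_le_sq_sum_of_nonneg fun k _ => h0 k

theorem bernoulliMean_ite {ι : Type*} [Fintype ι] [DecidableEq ι] {p : ℝ} (i : ι) (c : ℝ) :
    bernoulliMean p (fun ξ => if ξ i then c else 0) = p * c := by
  have h := bernoulliMean_first (p := p) i ∅ (by simp)
  have h2 := bernoulliMean_const_mul (p := p) c
    (fun ξ : ι → Bool => if ξ i = true ∧ ∀ k ∈ (∅ : Finset ι), ξ k = false then (1 : ℝ) else 0)
  rw [h] at h2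
  simpa [mul_comm] using h2

/-- By monotonicity each entry of a block is at most every entry of the preceding block, hence at
most their average. -/
theorem mul_sum_sq_le (hα : Antitone α) (hα0 : ∀ i, 0 ≤ α i) (l : ℕ) :
    s * ∑ r ∈ Finset.range s, α ((l + 1) * s + r) ^ 2 ≤
      (∑ r ∈ Finset.range s, α (l * s + r)) * ∑ r ∈ Finset.range s, α ((l + 1) * s + r) := by
  rw [Finset.mul_sum, Finset.mul_sum]
  refine Finset.sum_le_sum fun r _ => ?_
  have h : (s : ℝ) * α ((l + 1) * s + r) ≤ ∑ r ∈ Finset.range s, α (l * s + r) := by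
    have h2 : ∀ r' ∈ Finset.range s, α ((l + 1) * s + r) ≤ α (l * s + r') := by
      intro r' hr'
      refine hα ?_
      have := Finset.mem_range.1 hr'
      rw [Nat.succ_mul]
      omega
    simpa using Finset.card_nsmul_le_sum _ _ _ h2
  rw [sq, ← mul_assoc]
  exact mul_le_mul_of_nonneg_right h (hα0 _)

/-- Uses b_l b_{l+1} ≤ b_l²/4 + b_{l+1}². The shifted squares omit b_0², and this deficit later pays
for the first block. -/
theorem mul_sum_tail_sq_le (hα : Antitone α) (hα0 : ∀ i, 0 ≤ α i) (L : ℕ) :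
    (s : ℝ) * ∑ l ∈ Finset.range L, ∑ r ∈ Finset.range s, α ((l + 1) * s + r) ^ 2 ≤
      5 / 4 * ∑ l ∈ Finset.range (L + 1), (∑ r ∈ Finset.range s, α (l * s + r)) ^ 2 -
        (∑ r ∈ Finset.range s, α (0 * s + r)) ^ 2 := by
  set b : ℕ → ℝ := fun l => ∑ r ∈ Finset.range s, α (l * s + r) with hb
  have h1 : (s : ℝ) * ∑ l ∈ Finset.range L, ∑ r ∈ Finset.range s, α ((l + 1) * s + r) ^ 2 ≤
      ∑ l ∈ Finset.range L, (b l ^ 2 / 4 + b (l + 1) ^ 2) := by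
    rw [Finset.mul_sum]
    refine Finset.sum_le_sum fun l _ => (mul_sum_sq_le hα hα0 l).trans ?_
    change b l * b (l + 1) ≤ _
    nlinarith [sq_nonneg (b l / 2 - b (l + 1))]
  rw [Finset.sum_add_distrib, ← Finset.sum_div] at h1
  have h2 : ∑ l ∈ Finset.range (L + 1), b l ^ 2 =
      ∑ l ∈ Finset.range L, b (l + 1) ^ 2 + b 0 ^ 2 := Finset.sum_range_succ' _ _
  have h3 := Finset.sum_range_succ (fun l => b l ^ 2) L
  have h4 := sq_nonneg (b L)
  change _ ≤ 5 / 4 * ∑ l ∈ Finset.range (L + 1), b l ^ 2 - b 0 ^ 2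
  linarith

theorem sqrtMean_le (hs : 1 ≤ s) (hn : 0 < n) (hα : Antitone α) (hα0 : ∀ i, 0 ≤ α i)
    (hz : ∀ i, n ≤ i → α i = 0) :
    s * sqrtMean (1 / (s : ℝ)) (fun i : Fin n => α i) 0 ≤
      1.63 * √(∑ l ∈ Finset.range (n ⌈/⌉ s), (∑ r ∈ Finset.range s, α (l * s + r)) ^ 2) := by
  have hs' : (1 : ℝ) ≤ s := by exact_mod_cast hs
  have hspos : (0 : ℝ) < s := by linarith
  have hp0 : 0 ≤ 1 / (s : ℝ) := by positivity
  have hp1 : 1 / (s : ℝ) ≤ 1 := (div_le_one hspos).2 hs'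
  set p := 1 / (s : ℝ) with hp
  have hsp : (s : ℝ) * p = 1 := by rw [hp]; field_simp
  obtain ⟨L, hL⟩ : ∃ L, n ⌈/⌉ s = L + 1 := by
    have h := le_ceilDiv_mul (n := n) hs
    refine Nat.exists_eq_succ_of_ne_zero fun h0 => ?_
    rw [h0] at h
    omega
  set V : ℝ := ∑ l ∈ Finset.range (n ⌈/⌉ s), (∑ r ∈ Finset.range s, α (l * s + r)) ^ 2 with hV
  set b₀ : ℝ := ∑ r ∈ Finset.range s, α (0 * s + r) with hb₀
  have hblocks : ∀ c : ℕ → ℝ, (∀ i, n ≤ i → c i = 0) →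
      ∑ k : Fin n, (if (k : ℕ) < s then c k else 0) = ∑ r ∈ Finset.range s, c (0 * s + r) ∧
      ∑ k : Fin n, (if (k : ℕ) < s then 0 else c k) =
        ∑ l ∈ Finset.range L, ∑ r ∈ Finset.range s, c ((l + 1) * s + r) := by
    intro c hc
    have hlt : ∀ l r, ¬ (l + 1) * s + r < s := fun l r => by rw [Nat.succ_mul]; omega
    constructor
    · rw [sum_fin_eq_sum_blocks hs (fun k => if k < s then c k else 0)
        fun i hi => by simp [hc i hi], hL, Finset.sum_range_succ', Finset.sum_eq_zero, zero_add]
      · exact Finset.sum_congr rfl fun r hr => by simp [Finset.mem_range.1 hr]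
      · exact fun l _ => Finset.sum_eq_zero fun r _ => if_neg (hlt l r)
    · rw [sum_fin_eq_sum_blocks hs (fun k => if k < s then 0 else c k)
        fun i hi => by simp [hc i hi], hL, Finset.sum_range_succ']
      rw [Finset.sum_eq_zero (s := Finset.range s), add_zero]
      · exact Finset.sum_congr rfl fun l _ => Finset.sum_congr rfl fun r _ => if_neg (hlt l r)
      · exact fun r hr => by simp [Finset.mem_range.1 hr]
  set H : Finset (Fin n) := Finset.univ.filter fun k => (k : ℕ) < s with hH
  set T : Finset (Fin n) := Finset.univ.filter fun k => ¬ (k : ℕ) < s with hT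
  set f : (Fin n → Bool) → ℝ := fun ξ => √(∑ k ∈ T, if ξ k then α k ^ 2 else 0) with hf
  have hpoint : ∀ ξ : Fin n → Bool, √(0 + ∑ k : Fin n, if ξ k then α k ^ 2 else 0) ≤
      (∑ k ∈ H, if ξ k then α k else 0) + f ξ := by
    intro ξ
    rw [zero_add, ← Finset.sum_filter_add_sum_filter_not Finset.univ fun k : Fin n => (k : ℕ) < s]
    refine (sqrt_add_le_sqrt_add_sqrt ?_ ?_).trans ?_
    · exact Finset.sum_nonneg fun k _ => by split_ifs <;> positivity
    · exact Finset.sum_nonneg fun k _ => by split_ifs <;> positivity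
    · exact add_le_add_left (sqrt_sum_ite_sq_le _ ξ (a := fun k : Fin n => α k) fun _ => hα0 _) _
  have hmean := bernoulliMean_mono hp0 hp1 hpoint
  rw [bernoulliMean_add, bernoulliMean_sum] at hmean
  simp only [bernoulliMean_ite] at hmean
  rw [← Finset.mul_sum, hH, Finset.sum_filter, (hblocks α hz).1, ← hb₀] at hmean
  set μ := bernoulliMean p f with hμ
  have hμsq : (s * μ) ^ 2 ≤ 5 / 4 * V - b₀ ^ 2 := by
    have h1 := sq_bernoulliMean_le hp0 hp1 f
    have h2 : bernoulliMean p (fun ξ => f ξ ^ 2) = p * ∑ k ∈ T, α k ^ 2 := by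
      have h3 : ∀ ξ, f ξ ^ 2 = ∑ k ∈ T, if ξ k then α k ^ 2 else 0 := fun ξ =>
        Real.sq_sqrt (Finset.sum_nonneg fun k _ => by split_ifs <;> positivity)
      simp_rw [h3]
      rw [bernoulliMean_sum, Finset.mul_sum]
      exact Finset.sum_congr rfl fun k _ => bernoulliMean_ite k _
    have h4 : ∑ k ∈ T, α k ^ 2 =
        ∑ l ∈ Finset.range L, ∑ r ∈ Finset.range s, α ((l + 1) * s + r) ^ 2 := by
      rw [← (hblocks (fun k => α k ^ 2) fun i hi => by simp [hz i hi]).2, hT, Finset.sum_filter]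
      exact Finset.sum_congr rfl fun k _ => by split_ifs <;> rfl
    have h5 := mul_sum_tail_sq_le (s := s) hα hα0 L
    rw [← hL, ← hV, ← hb₀, ← h4] at h5
    rw [h2] at h1
    calc (s * μ) ^ 2 = s ^ 2 * μ ^ 2 := by ring
      _ ≤ s ^ 2 * (p * ∑ k ∈ T, α k ^ 2) := mul_le_mul_of_nonneg_left h1 (by positivity)
      _ = s * p * (s * ∑ k ∈ T, α k ^ 2) := by ring
      _ ≤ _ := by rw [hsp, one_mul]; exact h5
  have hV0 : 0 ≤ V := Finset.sum_nonneg fun _ _ => sq_nonneg _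
  calc s * sqrtMean p (fun i : Fin n => α i) 0 ≤ s * (p * b₀ + μ) :=
        mul_le_mul_of_nonneg_left hmean hspos.le
    _ = b₀ + s * μ := by rw [mul_add, ← mul_assoc, hsp, one_mul]
    _ ≤ 1.63 * √V := by
        refine le_of_sq_le_sq ?_ (by positivity)
        rw [mul_pow, Real.sq_sqrt hV0]
        -- (b₀ + sμ)² ≤ 2(b₀² + (sμ)²) ≤ (5/2)V, and 1.63² = 2.6569.
        nlinarith [sq_nonneg (b₀ - s * μ)]

end

/-- The mean of the rescaled sum of row norms is comparable to the block norm. -/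
theorem sqrtMean_bounds {n s : ℕ} (hs : 1 ≤ s) (hn : 0 < n) (x : Fin n → ℝ) :
    0.63 * blockNorm s x ≤ s * sqrtMean (1 / (s : ℝ)) x 0 ∧
      s * sqrtMean (1 / (s : ℝ)) x 0 ≤ 1.63 * blockNorm s x := by
  set σ := decreasingOrder x with hσ
  -- Padding by zeros keeps the rearrangement decreasing and completes a short last block.
  set α : ℕ → ℝ := fun i => if h : i < n then |x (σ ⟨i, h⟩)| else 0 with hαdef
  have hα0 : ∀ i, 0 ≤ α i := fun i => by
    simp only [hαdef]
    split_ifs <;> positivity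
  have hz : ∀ i, n ≤ i → α i = 0 := fun i hi => by simp [hαdef, not_lt.2 hi]
  have hα : Antitone α := by
    intro i j hij
    by_cases hj : j < n
    · have hi : i < n := lt_of_le_of_lt hij hj
      simp only [hαdef, hi, hj, dif_pos]
      exact decreasingOrder_antitone x (Fin.mk_le_mk.2 hij)
    · rw [hz j (not_lt.1 hj)]
      exact hα0 i
  have hαfin : ∀ i : Fin n, α i = |x (σ i)| := fun i => by simp [hαdef]
  have hmean : sqrtMean (1 / (s : ℝ)) (fun i : Fin n => α i) 0 = sqrtMean (1 / (s : ℝ)) x 0 := by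
    refine (bernoulliMean_comp_equiv σ _).symm.trans ?_
    rw [sqrtMean]
    congr 1
    ext ξ
    rw [← Equiv.sum_comp σ fun k => if ξ k = true then x k ^ 2 else 0]
    simp [hαfin]
  have hnorm : blockNorm s x =
      √(∑ l ∈ Finset.range (n ⌈/⌉ s), (∑ r ∈ Finset.range s, α (l * s + r)) ^ 2) := by
    rw [blockNorm]
    congr 1
    refine Finset.sum_congr rfl fun l hl => ?_
    congr 1
    rw [block, Finset.sum_filter, ← Equiv.sum_comp σ]
    simp only [← hσ, Equiv.symm_apply_apply, ← hαfin]
    rw [sum_fin_eq_sum_blocks hs (fun i => if i / s = l then α i else 0)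
      fun i hi => by simp [hz i hi], Finset.sum_eq_single l]
    · refine Finset.sum_congr rfl fun r hr => if_pos ?_
      rw [Nat.mul_comm, Nat.mul_add_div hs, Nat.div_eq_of_lt (Finset.mem_range.1 hr), add_zero]
    · intro l' _ hl'
      refine Finset.sum_eq_zero fun r hr => if_neg ?_
      rwa [Nat.mul_comm, Nat.mul_add_div hs, Nat.div_eq_of_lt (Finset.mem_range.1 hr), add_zero]
    · exact fun h => absurd hl h
  rw [hnorm, ← hmean]
  exact ⟨sqrtMean_ge hs hα hα0 hz, sqrtMean_le hs hn hα hα0 hz⟩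

/-! ### Laws of the random matrices, and integration over G given A. -/

/-- A linear combination of independent standard Gaussian variables is Gaussian. -/
theorem hasLaw_sum_mul_pi_gaussian {n : ℕ} (c : Fin n → ℝ) :
    HasLaw (fun g : Fin n → ℝ => ∑ k, c k * g k)
      (gaussianReal 0 (√(∑ k, c k ^ 2) ^ 2).toNNReal)
      (Measure.pi fun _ => gaussianReal 0 1) where
  aemeasurable := Measurable.aemeasurable (by fun_prop)
  map_eq := by
    have hind : iIndepFun (fun k (g : Fin n → ℝ) => c k * g k)
        (Measure.pi fun _ => gaussianReal 0 1) :=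
      iIndepFun_pi (X := fun k y => c k * y) fun k => by fun_prop
    refine Measure.ext_of_charFun ?_
    rw [hind.charFun_map_fun_sum_eq_prod fun k => Measurable.aemeasurable (by fun_prop)]
    have hmap : ∀ k, (Measure.pi fun _ : Fin n => gaussianReal 0 1).map
        (fun g => c k * g k) = gaussianReal 0 (NNReal.mk (c k ^ 2) (sq_nonneg _) * 1) := by
      intro k
      have h := (measurePreserving_eval (fun _ : Fin n => gaussianReal 0 1) k).map_eq
      have h2 := gaussianReal_map_const_mul (μ := 0) (v := 1) (c k)
      rw [mul_zero] at h2
      rw [← h2]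
      conv_rhs => rw [← h]
      rw [Measure.map_map (by fun_prop) (by fun_prop)]
      rfl
    ext t
    simp only [hmap, Finset.prod_apply, charFun_gaussianReal]
    rw [← Complex.exp_sum]
    congr 1
    have h3 : (((√(∑ k, c k ^ 2) ^ 2).toNNReal : ℝ) : ℂ) = ∑ k, (c k : ℂ) ^ 2 := by
      rw [Real.coe_toNNReal _ (sq_nonneg _),
        Real.sq_sqrt (Finset.sum_nonneg fun _ _ => sq_nonneg _)]
      push_cast
      rfl
    rw [h3]
    simp [Finset.sum_mul, Finset.sum_div]

theorem lintegral_pi_prod_eq {ι : Type*} [Fintype ι] {X : ι → Type*}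
    [∀ i, MeasurableSpace (X i)] (μ : ∀ i, Measure (X i)) [∀ i, IsProbabilityMeasure (μ i)]
    {f : ∀ i, X i → ENNReal} (hf : ∀ i, Measurable (f i)) :
    ∫⁻ y, ∏ i, f i (y i) ∂Measure.pi μ = ∏ i, ∫⁻ y, f i y ∂μ i := by
  rw [lintegral_prod_eq_prod_lintegral_of_indepFun Finset.univ _
    (iIndepFun_pi (X := f) fun i => (hf i).aemeasurable)
    fun i => (hf i).comp (measurable_pi_apply i)]
  refine Finset.prod_congr rfl fun i _ => ?_
  exact (measurePreserving_eval μ i).lintegral_comp (hf i)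

/-- A product measure over a product index set is an iterated product measure. -/
theorem map_uncurry_pi {ι κ X : Type*} [Fintype ι] [Fintype κ] [MeasurableSpace X]
    (μ : Measure X) [SigmaFinite μ] :
    (Measure.pi fun _ : ι => Measure.pi fun _ : κ => μ).map
      (fun g (p : ι × κ) => g p.1 p.2) = Measure.pi fun _ : ι × κ => μ := by
  symm
  refine Measure.pi_eq fun s hs => ?_
  rw [Measure.map_apply (by fun_prop) (MeasurableSet.univ_pi hs)]
  have h : (fun (g : ι → κ → X) (p : ι × κ) => g p.1 p.2) ⁻¹' Set.univ.pi s =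
      Set.univ.pi fun i => Set.univ.pi fun k => s (i, k) := by
    ext g
    simp
  rw [h, Measure.pi_pi]
  simp only [Measure.pi_pi, Fintype.prod_prod_type]

section

variable {Ω : Type*} [MeasurableSpace Ω] {P : Measure Ω} {m n : ℕ}
  {A G : Ω → Matrix (Fin m) (Fin n) ℝ}

theorem IsGaussianMatrix.hasLaw (hG : IsGaussianMatrix G P) :
    HasLaw (fun ω (p : Fin m × Fin n) => G ω p.1 p.2)
      ((Measure.pi fun _ : Fin m => Measure.pi fun _ : Fin n => gaussianReal 0 1).map
        fun g p => g p.1 p.2) P := by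
  rw [map_uncurry_pi]
  exact iIndepFun.hasLaw_pi (fun p => hG.hasLaw_entry p.1 p.2) hG.indep_entries

theorem IsRandomBinaryMatrix.hasLaw {d : ℕ} (hA : IsRandomBinaryMatrix d A P) :
    HasLaw (fun ω (p : Fin m × Fin n) => A ω p.1 p.2)
      ((Measure.pi fun _ : Fin n => uniformOn (binaryColumns m d)).map
        fun v p => v p.2 p.1) P := by
  have h := iIndepFun.hasLaw_pi hA.hasLaw_col hA.indep_cols
  have hswap : Measurable fun (v : Fin n → Fin m → ℝ) (p : Fin m × Fin n) => v p.2 p.1 := by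
    fun_prop
  refine ⟨hswap.comp_aemeasurable h.aemeasurable, ?_⟩
  rw [← h.map_eq, AEMeasurable.map_map_of_aemeasurable hswap.aemeasurable h.aemeasurable]
  rfl

/-- The `ℓ₁` norm of the image of `x` under the entrywise product of two matrices. -/
def hadamardNorm (x : Fin n → ℝ) (A G : Matrix (Fin m) (Fin n) ℝ) : ℝ :=
  ∑ j, |∑ k, A j k * G j k * x k|

theorem aemeasurable_hadamardNorm {d : ℕ} (hA : IsRandomBinaryMatrix d A P)
    (hG : IsGaussianMatrix G P) (x : Fin n → ℝ) :
    AEMeasurable (fun ω => hadamardNorm x (A ω) (G ω)) P := by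
  have hA' : ∀ j k, AEMeasurable (fun ω => A ω j k) P := fun j k =>
    (measurable_pi_apply (j, k)).comp_aemeasurable hA.hasLaw.aemeasurable
  have hG' : ∀ j k, AEMeasurable (fun ω => G ω j k) P := fun j k =>
    (hG.hasLaw_entry j k).aemeasurable
  unfold hadamardNorm
  refine Finset.aemeasurable_fun_sum _ fun j _ => ?_
  have : AEMeasurable (fun ω => ∑ k, A ω j k * G ω j k * x k) P :=
    Finset.aemeasurable_fun_sum _ fun k _ => ((hA' j k).mul (hG' j k)).mul_const _
  exact continuous_abs.measurable.comp_aemeasurable this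

/-- Independence of A and G turns the joint law into a product, so G can be integrated with A
frozen. -/
theorem lintegral_exp_hadamardNorm_eq [IsProbabilityMeasure P] {d : ℕ} (hd : d ≤ m)
    (hA : IsRandomBinaryMatrix d A P) (hG : IsGaussianMatrix G P) (hAG : IndepMatrices A G P)
    (x : Fin n → ℝ) (t : ℝ) :
    ∫⁻ ω, ENNReal.ofReal (Real.exp (t * hadamardNorm x (A ω) (G ω))) ∂P =
      ∫⁻ v, ∫⁻ g, ENNReal.ofReal (Real.exp (t * ∑ j, |∑ k, v k j * g j k * x k|))
        ∂(Measure.pi fun _ : Fin m => Measure.pi fun _ : Fin n => gaussianReal 0 1)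
        ∂(Measure.pi fun _ : Fin n => uniformOn (binaryColumns m d)) := by
  have := isProbabilityMeasure_uniformOn_binaryColumns hd
  have hlaw := IndepFun.hasLaw_prod hA.hasLaw hG.hasLaw hAG
  set F : (Fin m × Fin n → ℝ) × (Fin m × Fin n → ℝ) → ENNReal := fun q =>
    ENNReal.ofReal (Real.exp (t * ∑ j, |∑ k, q.1 (j, k) * q.2 (j, k) * x k|)) with hF
  have hFm : Measurable F := by fun_prop
  have h := hlaw.lintegral_comp hFm.aemeasurable
  rw [lintegral_prod _ hFm.aemeasurable, lintegral_map hFm.lintegral_prod_right' (by fun_prop)]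
    at h
  refine h.trans ?_
  congr 1
  ext v
  exact lintegral_map (hFm.comp measurable_prodMk_left) (by fun_prop)

/-- Rows are independent, so the exponential factors; each row sum is a centred Gaussian whose
standard deviation is the row norm. -/
theorem lintegral_exp_sum_abs_gaussian_le (a : Fin m → Fin n → ℝ) (t : ℝ) :
    ∫⁻ g, ENNReal.ofReal (Real.exp (t * ∑ j, |∑ k, a j k * g j k|))
        ∂(Measure.pi fun _ : Fin m => Measure.pi fun _ : Fin n => gaussianReal 0 1) ≤
      ENNReal.ofReal (Real.exp (t * β₀ * ∑ j, √(∑ k, a j k ^ 2)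
        + t ^ 2 * (∑ j, ∑ k, a j k ^ 2) / 2)) := by
  have h1 : ∀ g : Fin m → Fin n → ℝ,
      ENNReal.ofReal (Real.exp (t * ∑ j, |∑ k, a j k * g j k|)) =
        ∏ j, ENNReal.ofReal (Real.exp (t * |∑ k, a j k * g j k|)) := by
    intro g
    rw [Finset.mul_sum, Real.exp_sum, ENNReal.ofReal_prod_of_nonneg fun _ _ => (Real.exp_pos _).le]
  simp_rw [h1]
  rw [lintegral_pi_prod_eq (fun _ : Fin m => Measure.pi fun _ : Fin n => gaussianReal 0 1)
    (f := fun j y => ENNReal.ofReal (Real.exp (t * |∑ k, a j k * y k|)))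
    fun j => by fun_prop]
  refine (Finset.prod_le_prod' fun j _ => lintegral_exp_mul_abs_le (Real.sqrt_nonneg _)
    (hasLaw_sum_mul_pi_gaussian (a j)) t).trans (le_of_eq ?_)
  rw [← ENNReal.ofReal_prod_of_nonneg fun _ _ => (Real.exp_pos _).le, ← Real.exp_sum,
    Finset.sum_add_distrib]
  congr 3
  · rw [Finset.mul_sum]
  · rw [Finset.mul_sum, Finset.sum_div]
    refine Finset.sum_congr rfl fun j _ => ?_
    rw [Real.sq_sqrt (Finset.sum_nonneg fun _ _ => sq_nonneg _)]

theorem sum_eq_of_mem_binaryColumns {d : ℕ} {v : Fin m → ℝ} (hv : v ∈ binaryColumns m d) :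
    ∑ j, v j = d := by
  rw [binaryColumns_eq_image] at hv
  simp only [Finset.coe_map, Function.Embedding.coeFn_mk, Set.mem_image, Finset.mem_coe,
    Finset.mem_powersetCard, Finset.subset_univ, true_and] at hv
  obtain ⟨T, hT, rfl⟩ := hv
  simp [rowIndicator, hT]

theorem β₀_sq_le_one : β₀ ^ 2 ≤ 1 := by
  rw [β₀, Real.sq_sqrt (by positivity), div_le_one Real.pi_pos]
  exact Real.two_le_pi

/-- The `ℓ₁` norm of the image of a fixed vector is subgaussian about its mean. -/
theorem lintegral_exp_hadamardNorm_le [IsProbabilityMeasure P] {d : ℕ} (hm : 0 < m) (hd : d ≤ m)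
    (hA : IsRandomBinaryMatrix d A P) (hG : IsGaussianMatrix G P) (hAG : IndepMatrices A G P)
    (x : Fin n → ℝ) (t : ℝ) :
    ∫⁻ ω, ENNReal.ofReal (Real.exp (t * hadamardNorm x (A ω) (G ω))) ∂P ≤
      ENNReal.ofReal (Real.exp (t * (β₀ * (m * sqrtMean ((d : ℝ) / m) x 0))
        + t ^ 2 * (4 * (d * ∑ k, x k ^ 2)) / 2)) := by
  have := isProbabilityMeasure_uniformOn_binaryColumns hd
  rw [lintegral_exp_hadamardNorm_eq hd hA hG hAG]
  set D : ℝ := d * ∑ k, x k ^ 2 with hD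
  have hD0 : 0 ≤ D := by positivity
  have hinner : ∀ v : Fin n → Fin m → ℝ, (∀ k, v k ∈ binaryColumns m d) →
      ∫⁻ g, ENNReal.ofReal (Real.exp (t * ∑ j, |∑ k, v k j * g j k * x k|))
        ∂(Measure.pi fun _ : Fin m => Measure.pi fun _ : Fin n => gaussianReal 0 1) ≤
      ENNReal.ofReal (Real.exp (t ^ 2 * D / 2)) *
        ENNReal.ofReal (Real.exp (t * β₀ * ∑ j, √(0 + ∑ k, v k j * x k ^ 2))) := by
    intro v hv
    -- Entries 0 and 1 equal their squares.
    have hsq : ∀ j k, (v k j * x k) ^ 2 = v k j * x k ^ 2 := by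
      intro j k
      rcases (hv k).1 j with h | h <;> simp [h]
    have h := lintegral_exp_sum_abs_gaussian_le (fun j k => v k j * x k) t
    have hcomm : ∀ (g : Fin m → Fin n → ℝ) j k,
        v k j * x k * g j k = v k j * g j k * x k := fun _ _ _ => by ring
    have hsum : ∑ j, ∑ k, v k j * x k ^ 2 = D := by
      rw [Finset.sum_comm, hD, Finset.mul_sum]
      refine Finset.sum_congr rfl fun k _ => ?_
      rw [← Finset.sum_mul, sum_eq_of_mem_binaryColumns (hv k)]
    simp only [hcomm, hsq, hsum] at h
    refine h.trans (le_of_eq ?_)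
    rw [← ENNReal.ofReal_mul (Real.exp_pos _).le, ← Real.exp_add, add_comm]
    simp only [zero_add]
  have hae : ∀ᵐ v ∂(Measure.pi fun _ : Fin n => uniformOn (binaryColumns m d)),
      ∀ k, v k ∈ binaryColumns m d :=
    ae_all_iff.2 fun k =>
      (Measure.quasiMeasurePreserving_eval (fun _ : Fin n => uniformOn (binaryColumns m d)) k).ae
        ae_mem_binaryColumns
  refine (lintegral_mono_ae (hae.mono hinner)).trans ?_
  rw [lintegral_const_mul _ (by fun_prop)]
  refine (mul_le_mul_right
    (lintegral_exp_sum_sqrt_le hm hd (t * β₀) x (fun _ => 0) fun _ => le_rfl) _).trans ?_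
  rw [← ENNReal.ofReal_mul (Real.exp_pos _).le, ← Real.exp_add, ← hD]
  refine ENNReal.ofReal_le_ofReal (Real.exp_le_exp.2 ?_)
  rw [Finset.sum_const, Finset.card_univ, Fintype.card_fin, nsmul_eq_mul]
  -- The Gaussian stage contributes variance proxy D and the columns β₀²D ≤ D; 4D leaves room and
  -- produces the 8 in the final exponent.
  have h1 : t ^ 2 * D * β₀ ^ 2 ≤ t ^ 2 * D * 1 :=
    mul_le_mul_of_nonneg_left β₀_sq_le_one (by positivity)
  have h2 : 0 ≤ t ^ 2 * D := by positivity
  nlinarith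

/-! ### Chernoff bounds and normalization. -/

/-- The Chernoff bound for a variable with a subgaussian moment generating function. -/
theorem measureReal_ge_le_of_lintegral_exp_le [IsProbabilityMeasure P] {Y : Ω → ℝ}
    (hY : AEMeasurable Y P) {μ v : ℝ} (hv : 0 < v)
    (h : ∀ t : ℝ, ∫⁻ ω, ENNReal.ofReal (Real.exp (t * Y ω)) ∂P ≤
      ENNReal.ofReal (Real.exp (t * μ + t ^ 2 * v / 2))) (u : ℝ) (hu : 0 ≤ u) :
    P.real {ω | μ + u ≤ Y ω} ≤ Real.exp (-(u ^ 2 / (2 * v))) := by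
  -- The minimizer of t²v/2 - tu.
  set t := u / v with ht
  have ht0 : 0 ≤ t := by positivity
  have hY' : AEMeasurable (fun ω => ENNReal.ofReal (Real.exp (t * Y ω))) P :=
    (Real.measurable_exp.comp_aemeasurable (hY.const_mul t)).ennreal_ofReal
  have hmarkov := mul_meas_ge_le_lintegral₀ hY' (ENNReal.ofReal (Real.exp (t * (μ + u))))
  have hsub : {ω | μ + u ≤ Y ω} ⊆ {ω | ENNReal.ofReal (Real.exp (t * (μ + u))) ≤
      ENNReal.ofReal (Real.exp (t * Y ω))} := fun ω hω =>
    ENNReal.ofReal_le_ofReal (Real.exp_le_exp.2 (mul_le_mul_of_nonneg_left hω ht0))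
  have h2 := ((mul_le_mul_right (measure_mono hsub) _).trans hmarkov).trans (h t)
  have h3 := ENNReal.toReal_mono ENNReal.ofReal_ne_top h2
  rw [ENNReal.toReal_mul, ENNReal.toReal_ofReal (Real.exp_pos _).le,
    ENNReal.toReal_ofReal (Real.exp_pos _).le, ← le_div_iff₀' (Real.exp_pos _),
    ← Real.exp_sub] at h3
  refine h3.trans_eq ?_
  congr 1
  rw [ht]
  field_simp
  ring

/-- The two-sided form of the Chernoff bound. -/
theorem measureReal_abs_sub_ge_le_of_lintegral_exp_le [IsProbabilityMeasure P] {Y : Ω → ℝ}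
    (hY : AEMeasurable Y P) {μ v : ℝ} (hv : 0 < v)
    (h : ∀ t : ℝ, ∫⁻ ω, ENNReal.ofReal (Real.exp (t * Y ω)) ∂P ≤
      ENNReal.ofReal (Real.exp (t * μ + t ^ 2 * v / 2))) (u : ℝ) (hu : 0 ≤ u) :
    P.real {ω | u ≤ |Y ω - μ|} ≤ 2 * Real.exp (-(u ^ 2 / (2 * v))) := by
  have h1 := measureReal_ge_le_of_lintegral_exp_le hY hv h u hu
  have h2 := measureReal_ge_le_of_lintegral_exp_le (Y := fun ω => -Y ω) (μ := -μ) hY.neg hv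
    (fun t => by simpa using h (-t)) u hu
  have hsub : {ω | u ≤ |Y ω - μ|} ⊆ {ω | μ + u ≤ Y ω} ∪ {ω | -μ + u ≤ -Y ω} := by
    intro ω hω
    rcases le_abs.1 (show u ≤ |Y ω - μ| from hω) with h | h
    · exact Or.inl (show μ + u ≤ Y ω by linarith)
    · exact Or.inr (show -μ + u ≤ -Y ω by linarith)
  have h3 := (measureReal_mono hsub).trans (measureReal_union_le (μ := P) _ _)
  linarith

end

theorem norm_Psi_mulVec {m n : ℕ} (s : ℕ) (A G : Matrix (Fin m) (Fin n) ℝ) (x : Fin n → ℝ) :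
    ‖WithLp.toLp 1 (Psi s A G *ᵥ x)‖ =
      √(Real.pi / 2) * ((s : ℝ) / (m : ℝ)) * hadamardNorm x A G := by
  rw [PiLp.norm_eq_of_L1, hadamardNorm, Finset.mul_sum]
  refine Finset.sum_congr rfl fun j _ => ?_
  have h0 : 0 ≤ √(Real.pi / 2) * ((s : ℝ) / (m : ℝ)) := by positivity
  rw [Psi, Matrix.smul_mulVec, Real.norm_eq_abs]
  change |√(Real.pi / 2) * ((s : ℝ) / (m : ℝ)) * ∑ k, (A ⊙ G) j k * x k| = _
  rw [abs_mul, abs_of_nonneg h0]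
  rfl

theorem sqrt_pi_div_two_mul_β₀ : √(Real.pi / 2) * β₀ = 1 := by
  rw [β₀, ← Real.sqrt_mul (by positivity)]
  have h : Real.pi / 2 * (2 / Real.pi) = 1 := by
    have := Real.pi_ne_zero
    field_simp
  rw [h, Real.sqrt_one]

theorem β₀_pos : 0 < β₀ := by
  unfold β₀
  positivity

end BlockEmbedding

theorem theorem1 {Ω : Type*} [MeasurableSpace Ω] (P : Measure Ω) [IsProbabilityMeasure P]
    (m n s : ℕ) (hs : 1 ≤ s) (hsn : s ≤ n) (hsm : s ∣ m) (ε : ℝ) (hε : 0 < ε)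
    (A G : Ω → Matrix (Fin m) (Fin n) ℝ)
    (hA : BlockEmbedding.IsRandomBinaryMatrix (m / s) A P)
    (hG : BlockEmbedding.IsGaussianMatrix G P)
    (hAG : BlockEmbedding.IndepMatrices A G P)
    (x : Fin n → ℝ) :
    1 - 4 * (n : ℝ) * Real.exp (-(ε ^ 2 * (m : ℝ) / 8))
        - 2 * Real.exp (-(ε ^ 2 * BlockEmbedding.β₀ ^ 2 * ((m : ℝ) / (8 * (s : ℝ))) *
            (BlockEmbedding.blockNorm s x / ‖WithLp.toLp 2 x‖) ^ 2)) <
      P.real {ω |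
        (0.63 - ε) * BlockEmbedding.blockNorm s x
            ≤ ‖WithLp.toLp 1 (BlockEmbedding.Psi s (A ω) (G ω) *ᵥ x)‖ ∧
        ‖WithLp.toLp 1 (BlockEmbedding.Psi s (A ω) (G ω) *ᵥ x)‖
            ≤ (1.63 + ε) * BlockEmbedding.blockNorm s x} := by
  set N := BlockEmbedding.blockNorm s x with hN
  set E : Set Ω := {ω | (0.63 - ε) * N
            ≤ ‖WithLp.toLp 1 (BlockEmbedding.Psi s (A ω) (G ω) *ᵥ x)‖ ∧
        ‖WithLp.toLp 1 (BlockEmbedding.Psi s (A ω) (G ω) *ᵥ x)‖ ≤ (1.63 + ε) * N} with hE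
  have hn : 0 < n := lt_of_lt_of_le hs hsn
  have hn' : (0 : ℝ) < n := by exact_mod_cast hn
  have hs' : (0 : ℝ) < s := by exact_mod_cast hs
  have hexp : 0 < 4 * (n : ℝ) * Real.exp (-(ε ^ 2 * (m : ℝ) / 8)) := by positivity
  have hE0 : 0 ≤ P.real E := measureReal_nonneg
  obtain ⟨d, rfl⟩ := hsm
  rw [Nat.mul_div_cancel_left d hs] at hA
  -- For d = 0 or x = 0 the last exponential equals 1, so the claimed lower bound is negative.
  rcases Nat.eq_zero_or_pos d with hd0 | hd0
  · simp only [hd0, mul_zero, Nat.cast_zero, zero_div, zero_mul, neg_zero, Real.exp_zero] at hexp ⊢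
    linarith
  by_cases hx : x = 0
  · have hzero : ‖WithLp.toLp 2 x‖ = 0 := by simp [hx]
    rw [hzero, div_zero, zero_pow two_ne_zero, mul_zero, neg_zero, Real.exp_zero]
    linarith
  have hd' : (0 : ℝ) < d := by exact_mod_cast hd0
  have hm : 0 < s * d := Nat.mul_pos hs hd0
  have hdm : d ≤ s * d := Nat.le_mul_of_pos_left d hs
  have hnorm : ‖WithLp.toLp 2 x‖ ^ 2 = ∑ k, x k ^ 2 := EuclideanSpace.real_norm_sq_eq _
  have hS : 0 < ∑ k, x k ^ 2 := by
    rw [← hnorm]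
    have : WithLp.toLp 2 x ≠ 0 := fun h => hx (by simpa using h)
    positivity
  have hN0 : 0 ≤ N := Real.sqrt_nonneg _
  have hβ := BlockEmbedding.β₀_pos
  set β := BlockEmbedding.β₀ with hβdef
  have hp : (d : ℝ) / ((s * d : ℕ) : ℝ) = 1 / s := by
    push_cast
    field_simp
  obtain ⟨hlow, hup⟩ := BlockEmbedding.sqrtMean_bounds hs hn x
  rw [← hN] at hlow hup
  set Y : Ω → ℝ := fun ω => BlockEmbedding.hadamardNorm x (A ω) (G ω) with hY
  set c : ℝ := BlockEmbedding.sqrtMean (1 / (s : ℝ)) x 0 with hc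
  -- Since Y = β₀ d ‖Ψx‖₁, a deviation εβ₀dN of Y is a deviation εN of the normalized norm.
  have htail := BlockEmbedding.measureReal_abs_sub_ge_le_of_lintegral_exp_le
    (BlockEmbedding.aemeasurable_hadamardNorm hA hG x) (v := 4 * (d * ∑ k, x k ^ 2))
    (by positivity)
    (BlockEmbedding.lintegral_exp_hadamardNorm_le hm hdm hA hG hAG x) (ε * (β * d * N))
    (by positivity)
  rw [hp, ← hc, ← hβdef] at htail
  have hnormY : ∀ ω, β * d * ‖WithLp.toLp 1 (BlockEmbedding.Psi s (A ω) (G ω) *ᵥ x)‖ = Y ω := by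
    intro ω
    rw [BlockEmbedding.norm_Psi_mulVec]
    calc _ = √(Real.pi / 2) * β * (d * (s / ((s * d : ℕ) : ℝ))) * Y ω := by ring
      _ = Y ω := by
        rw [hβdef, BlockEmbedding.sqrt_pi_div_two_mul_β₀]
        push_cast
        field_simp
  have hcompl : Eᶜ ⊆ {ω | ε * (β * d * N) ≤ |Y ω - β * (((s * d : ℕ) : ℝ) * c)|} := by
    intro ω hω
    by_contra hlt
    refine hω ?_
    have hlt' : |Y ω - β * (((s * d : ℕ) : ℝ) * c)| < ε * (β * d * N) := not_le.1 hlt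
    rw [abs_lt] at hlt'
    rw [← hnormY ω] at hlt'
    push_cast at hlt'
    have hβd : 0 < β * d := by positivity
    have hl := mul_le_mul_of_nonneg_left hlow hβd.le
    have hu := mul_le_mul_of_nonneg_left hup hβd.le
    constructor
    · refine le_of_mul_le_mul_left ?_ hβd
      nlinarith [hlt'.1]
    · refine le_of_mul_le_mul_left ?_ hβd
      nlinarith [hlt'.2]
  have hexponent : (ε * (β * d * N)) ^ 2 / (2 * (4 * (d * ∑ k, x k ^ 2))) =
      ε ^ 2 * β ^ 2 * (((s * d : ℕ) : ℝ) / (8 * (s : ℝ))) * (N / ‖WithLp.toLp 2 x‖) ^ 2 := by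
    rw [div_pow, hnorm]
    push_cast
    field_simp
    ring
  rw [hexponent] at htail
  have hone : 1 ≤ P.real E + P.real Eᶜ := by
    have h := measureReal_union_le (μ := P) E Eᶜ
    rwa [Set.union_compl_self, probReal_univ] at h
  have := measureReal_mono (μ := P) hcompl
  -- The two-sided tail accounts for the last exponential; the positive term with factor 4n makes
  -- the inequality strict.
  linarith
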